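/- Let $\gamma>0$ and let $\Phi:\mathbb R^d\to\mathbb R$ be twice continuously differentiable with $\nabla^2\Phi(z)\succeq\gamma I$ for all $z$, such that $p=e^{-\Phi}$ is a probability density. Let $z_0\sim p$ and $z_1\sim\mathcal N(0,I)$ be independent. Let $\alpha,\sigma$ be real functions on $[0,1]$ and put $z_t=\alpha(t)z_0+\sigma(t)z_1$. Fix $t\in(0,1]$ such that $\alpha,\sigma$ are differentiable at $t$ (from the left if $t=1$; derivatives in time on $[0,1]$ are denoted by a dot or $\frac{\mathrm d}{\mathrm dt}$) and $\sigma(t)>0$. Put $$c(t)=\Bigl(\dot\alpha(t)-\frac{\dot\sigma(t)\alpha(t)}{\sigma(t)}\Bigr)\frac{\alpha(t)}{\sigma(t)^2}=\frac12\,\frac{\mathrm d}{\mathrm dt}\,\frac{\alpha(t)^2}{\sigma(t)^2}.$$ Then the conditional expectation $v(z,t)=\mathbb E[\dot\alpha(t)z_0+\dot\sigma(t)z_1\mid z_t=z]$ has exactly one version that is continuous in $z$ (the velocity field at time $t$); it is differentiable in $z$, and its Jacobian satisfies the following. If $c(t)\le0$, then for all $z\in\mathbb R^d$ $$\frac{\mathrm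 d}{\mathrm dt}\Bigl(\tfrac12\log\bigl(\alpha(t)^2+\gamma\,\sigma(t)^2\bigr)\Bigr)I\;\preceq\;\nabla_z v(z,t)\;\preceq\;\frac{\mathrm d}{\mathrm dt}\bigl(\log\sigma(t)\bigr)I.$$ If $c(t)<0$, then moreover the upper bound is strict: $\nabla_z v(z,t)\prec\frac{\mathrm d}{\mathrm dt}(\log\sigma(t))\,I$ for all $z\in\mathbb R^d$. In particular, for $\alpha(t)=1-t$ and $\sigma(t)=t$ both bounds hold for all $t\in(0,1]$ and all $z\in\mathbb R^d$; for $t\in(0,1)$ one has $c(t)<0$ and the upper bound is strict. Here $A\preceq B$ ($A\prec B$) means that $B-A$ is symmetric positive semidefinite (definite). -/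

import Mathlib

open MeasureTheory ProbabilityTheory Set

noncomputable section

/-- Hessian matrix of `Φ` at `x`. -/
def hessianMatrix {d : ℕ} (Φ : EuclideanSpace ℝ (Fin d) → ℝ) (x : EuclideanSpace ℝ (Fin d)) :
    Matrix (Fin d) (Fin d) ℝ :=
  fun i j => iteratedFDeriv ℝ 2 Φ x ![EuclideanSpace.single i 1, EuclideanSpace.single j 1]

/-- Jacobian matrix `(∂ v_i / ∂ z_j)` of `v` at `z`. -/
def jacobianMatrix {d : ℕ} (v : EuclideanSpace ℝ (Fin d) → EuclideanSpace ℝ (Fin d))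
    (z : EuclideanSpace ℝ (Fin d)) : Matrix (Fin d) (Fin d) ℝ :=
  fun i j => fderiv ℝ v z (EuclideanSpace.single j 1) i

/-- `exp (-Φ)` is a `γ`-strongly log-concave density with a twice continuously differentiable
potential: `∇²Φ ⪰ γ I` everywhere. -/
structure StronglyLogConcavePotential {d : ℕ} (γ : ℝ) (Φ : EuclideanSpace ℝ (Fin d) → ℝ) :
    Prop where
  contDiff : ContDiff ℝ 2 Φ
  hessian_ge : ∀ x, (hessianMatrix Φ x - γ • (1 : Matrix (Fin d) (Fin d) ℝ)).PosSemidef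

/-- The measure with Lebesgue density `exp (-Φ)`. -/
def densityMeasure {d : ℕ} (Φ : EuclideanSpace ℝ (Fin d) → ℝ) :
    Measure (EuclideanSpace ℝ (Fin d)) :=
  volume.withDensity fun x => ENNReal.ofReal (Real.exp (-Φ x))

/-- Time derivative on `[0, 1]` (one-sided at the endpoints). -/
def timeDeriv (f : ℝ → ℝ) (t : ℝ) : ℝ := derivWithin f (Icc 0 1) t

/-- The interpolant `z_t = α(t) z₀ + σ(t) z₁`. -/
def interpolant {Ω : Type*} {d : ℕ} (α σ : ℝ → ℝ) (Z₀ Z₁ : Ω → EuclideanSpace ℝ (Fin d)) (t : ℝ) :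
    Ω → EuclideanSpace ℝ (Fin d) :=
  fun ω => α t • Z₀ ω + σ t • Z₁ ω

/-- `v` is the velocity field `v(·, t)` of the interpolant at time `t`: the continuous version of
`z ↦ E[α'(t) z₀ + σ'(t) z₁ | z_t = z]`. -/
structure IsVelocityFieldAt {Ω : Type*} [MeasurableSpace Ω] (μ : Measure Ω) {d : ℕ}
    (α σ : ℝ → ℝ) (Z₀ Z₁ : Ω → EuclideanSpace ℝ (Fin d)) (t : ℝ)
    (v : EuclideanSpace ℝ (Fin d) → EuclideanSpace ℝ (Fin d)) : Prop where
  continuous : Continuous v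
  ae_eq_condExp : (fun ω => v (interpolant α σ Z₀ Z₁ t ω)) =ᵐ[μ]
    μ[fun ω => timeDeriv α t • Z₀ ω + timeDeriv σ t • Z₁ ω |
      MeasurableSpace.comap (interpolant α σ Z₀ Z₁ t) inferInstance]

/-- `c(t) = (α'(t) - σ'(t) α(t) / σ(t)) α(t) / σ(t)²`. -/
def covCoeff (α σ : ℝ → ℝ) (t : ℝ) : ℝ :=
  (timeDeriv α t - timeDeriv σ t * α t / σ t) * (α t / σ t ^ 2)

/-- `d/dt (½ log (α(t)² + γ σ(t)²))`. -/
def lowerRate (γ : ℝ) (α σ : ℝ → ℝ) (t : ℝ) : ℝ :=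
  timeDeriv (fun s => 1 / 2 * Real.log (α s ^ 2 + γ * σ s ^ 2)) t

/-- `d/dt log σ(t)`. -/
def upperRate (σ : ℝ → ℝ) (t : ℝ) : ℝ := timeDeriv (fun s => Real.log (σ s)) t

end

/-! ### Midpoint Prékopa–Leindler inequality. -/

section PrekopaLeindler

open scoped ENNReal

/-! Eliminating `z₁ = (z_t - α z₀) / σ` gives `v(z) = (σ'/σ) z + (α' - σ' α / σ) E[z₀ | z_t = z]`.
The posterior of `z₀` has density proportional to `exp ⟪h, x⟫ * k x` with `h = (α/σ²) z` and `k =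
exp (-Φ - (α²/σ²) ‖x‖² / 2)`, an exponential family in `h`. The derivative of its mean in `h` is its
covariance, so by the chain rule the Jacobian of `v` is `(σ'/σ) I + c(t) Cov`. For `c(t) ≤ 0` the
upper bound is `Cov ⪰ 0`, strict when `c(t) < 0` because `Cov` is positive definite. The lower bound
is `Cov ⪯ (γ + α²/σ²)⁻¹ I`, since `lowerRate_eq` identifies the lower rate as `σ'/σ + c(t) / (γ +
α²/σ²)`.

The covariance bound is Brascamp–Lieb for linear functions, obtained from Prékopa–Leindler: for a
`c`-strongly log-concave weight with tilted mass `M`, `M(h+u) M(h-u) ≤ exp (‖u‖²/c) M(h)²`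
(`tiltMass_mul_tiltMass_le`). The second-order expansion of the logarithm at `u = 0` bounds the
Hessian of `log M`, which is the covariance.

The formula for `v` is a version of the conditional expectation by Fubini on the joint density of
`(z_t, z₀)` (`setIntegral_posteriorMean`). It is the only continuous one because Lebesgue measure is
absolutely continuous with respect to the law of `z_t` (`volume_absolutelyContinuous_map`). -/

theorem volume_add_le_of_isCompact {A B S : Set ℝ} (hA : IsCompact A) (hB : IsCompact B)
    (hAne : A.Nonempty) (hBne : B.Nonempty) (h : ∀ a ∈ A, ∀ b ∈ B, a + b ∈ S) :
    volume A + volume B ≤ volume S := by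
  obtain ⟨a, ha, hamax⟩ := hA.exists_isGreatest hAne
  obtain ⟨b, hb, hbmin⟩ := hB.exists_isLeast hBne
  have hAm : volume ((fun x => x + b) '' A) = volume A := by
    simp
  have hBm : volume ((fun x => a + x) '' B) = volume B := by
    simp
  have hBc : MeasurableSet ((fun x => a + x) '' B) :=
    (hB.image (by fun_prop)).measurableSet
  -- With `a = max A` and `b = min B`, the translates `A + b` and `a + B` both lie in `S` and can
  -- meet only at `a + b`.
  have hdisj : AEDisjoint volume ((fun x => x + b) '' A) ((fun x => a + x) '' B) := by
    refine measure_mono_null (t := {a + b}) ?_ (by simp)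
    rintro _ ⟨⟨x, hx, rfl⟩, ⟨y, hy, hxy⟩⟩
    have h1 := hamax hx
    have h2 := hbmin hy
    simp only [mem_singleton_iff] at hxy ⊢
    linarith
  rw [← hAm, ← hBm, ← measure_union₀ hBc.nullMeasurableSet hdisj]
  refine measure_mono ?_
  rintro _ (⟨x, hx, rfl⟩ | ⟨y, hy, rfl⟩)
  · exact h x hx b hb
  · exact h a ha y hy

/-- The one-dimensional Brunn–Minkowski inequality. -/
theorem volume_add_le_of_add_mem {A B S : Set ℝ} (hA : MeasurableSet A) (hB : MeasurableSet B)
    (hAne : A.Nonempty) (hBne : B.Nonempty) (h : ∀ a ∈ A, ∀ b ∈ B, a + b ∈ S) :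
    volume A + volume B ≤ volume S := by
  obtain ⟨a, ha⟩ := hAne
  obtain ⟨b, hb⟩ := hBne
  -- Inner regularity is applied to `B`, then to `A`; inserting `a` and `b` keeps the compact
  -- subsets nonempty.
  have key : ∀ K ⊆ A, IsCompact K → volume K + volume B ≤ volume S := by
    intro K hKA hK
    have hK' : IsCompact (insert a K) := hK.insert a
    have hKfin : volume (insert a K) ≠ ⊤ := hK'.measure_lt_top.ne
    have hle : ∀ L ⊆ B, IsCompact L → volume (insert a K) + volume L ≤ volume S := by
      intro L hLB hL
      refine le_trans (add_le_add le_rfl (measure_mono (subset_insert b L))) ?_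
      refine volume_add_le_of_isCompact hK' (hL.insert b) (insert_nonempty _ _)
        (insert_nonempty _ _) fun x hx y hy => h x ?_ y ?_
      · exact insert_subset ha hKA hx
      · exact insert_subset hb hLB hy
    have hB' : volume B ≤ volume S - volume (insert a K) := by
      rw [hB.measure_eq_iSup_isCompact]
      refine iSup₂_le fun L hLB => iSup_le fun hL => ?_
      exact ENNReal.le_sub_of_add_le_left hKfin (hle L hLB hL)
    have hKS : volume (insert a K) ≤ volume S := by
      simpa using hle ∅ (empty_subset _) isCompact_empty
    calc volume K + volume B ≤ volume (insert a K) + (volume S - volume (insert a K)) :=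
          add_le_add (measure_mono (subset_insert _ _)) hB'
      _ = volume S := add_tsub_cancel_of_le hKS
  have hBS : volume B ≤ volume S := by
    simpa using key ∅ (empty_subset _) isCompact_empty
  by_cases hBtop : volume B = ⊤
  · rw [hBtop, top_le_iff] at hBS
    simp [hBS]
  have hA' : volume A ≤ volume S - volume B := by
    rw [hA.measure_eq_iSup_isCompact]
    refine iSup₂_le fun K hKA => iSup_le fun hK => ?_
    exact ENNReal.le_sub_of_add_le_right hBtop (key K hKA hK)
  calc volume A + volume B ≤ (volume S - volume B) + volume B := add_le_add hA' le_rfl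
    _ = volume S := tsub_add_cancel_of_le hBS

theorem lintegral_eq_lintegral_volume_lt {f : ℝ → ℝ≥0∞} (hf : Measurable f) (hf1 : ∀ x, f x ≤ 1) :
    ∫⁻ x, f x = ∫⁻ t in Ioi (0 : ℝ), volume {x | ENNReal.ofReal t < f x} := by
  have hne : ∀ x, f x ≠ ⊤ := fun x => ((hf1 x).trans_lt ENNReal.one_lt_top).ne
  have := lintegral_eq_lintegral_meas_lt (volume : Measure ℝ) (f := fun x => (f x).toReal)
    (Filter.Eventually.of_forall fun x => ENNReal.toReal_nonneg) hf.ennreal_toReal.aemeasurable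
  simp only [ENNReal.ofReal_toReal (hne _)] at this
  rw [this]
  refine setLIntegral_congr_fun measurableSet_Ioi fun t ht => ?_
  congr 1
  ext x
  exact (ENNReal.ofReal_lt_iff_lt_toReal (le_of_lt ht) (hne x)).symm

/-- For `t < 1` the normalisation makes both superlevel sets nonempty, and `f a > t`, `g b > t`
force `H ((a + b) / 2) > t`. Brunn–Minkowski compares the level sets and the layer-cake formula
integrates over `t`. -/
theorem lintegral_add_le_of_iSup_eq_one {f g H : ℝ → ℝ≥0∞} (hf : Measurable f)
    (hg : Measurable g) (hH : Measurable H) (hf1 : ⨆ x, f x = 1) (hg1 : ⨆ x, g x = 1)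
    (h : ∀ x y, f x * g y ≤ H ((x + y) / 2) ^ 2) :
    (∫⁻ x, f x) + ∫⁻ x, g x ≤ 2 * ∫⁻ x, H x := by
  have hfle : ∀ x, f x ≤ 1 := fun x => hf1 ▸ le_iSup f x
  have hgle : ∀ x, g x ≤ 1 := fun x => hg1 ▸ le_iSup g x
  -- Truncating `H` at `1` preserves the hypothesis because `f, g ≤ 1`, and makes the layer-cake
  -- lemma applicable.
  set K : ℝ → ℝ≥0∞ := fun x => min (H x) 1 with hK
  have hKm : Measurable K := hH.min measurable_const
  have hKle : ∀ x, K x ≤ 1 := fun x => min_le_right _ _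
  have hKh : ∀ x y, f x * g y ≤ K ((x + y) / 2) ^ 2 := by
    intro x y
    simp only [hK]
    rcases min_choice (H ((x + y) / 2)) 1 with h' | h' <;> rw [h']
    · exact h x y
    · simpa using mul_le_mul' (hfle x) (hgle y)
  refine le_trans ?_ (mul_le_mul' le_rfl (lintegral_mono (fun x => min_le_left (H x) 1)))
  change _ ≤ 2 * ∫⁻ x, K x
  rw [lintegral_eq_lintegral_volume_lt hf hfle, lintegral_eq_lintegral_volume_lt hg hgle,
    lintegral_eq_lintegral_volume_lt hKm hKle, ← lintegral_const_mul' _ _ (by simp),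
    ← lintegral_add_left']
  swap
  · refine (Antitone.measurable fun s t hst => measure_mono fun x hx => ?_).aemeasurable
    exact lt_of_le_of_lt (ENNReal.ofReal_le_ofReal hst) hx
  refine setLIntegral_mono' measurableSet_Ioi fun t ht => ?_
  rcases lt_or_ge t 1 with ht1 | ht1
  · have hof : ENNReal.ofReal t < 1 := by simpa using ht1
    have hA : {x | ENNReal.ofReal t < f x}.Nonempty := by
      rw [← hf1] at hof
      exact lt_iSup_iff.1 hof
    have hB : {x | ENNReal.ofReal t < g x}.Nonempty := by
      rw [← hg1] at hof
      exact lt_iSup_iff.1 hof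
    refine (volume_add_le_of_add_mem (S := (fun x => 2⁻¹ * x) ⁻¹' {x | ENNReal.ofReal t < K x})
      (measurableSet_lt measurable_const hf) (measurableSet_lt measurable_const hg) hA hB ?_).trans
      ?_
    · intro a ha b hb
      simp only [mem_preimage, mem_ofPred_eq] at ha hb ⊢
      by_contra hcon
      rw [not_lt] at hcon
      have h1 := hKh a b
      rw [div_eq_inv_mul] at h1
      have h2 : f a * g b ≤ ENNReal.ofReal t * ENNReal.ofReal t := by
        refine h1.trans ?_
        rw [sq]
        exact mul_le_mul' hcon hcon
      exact absurd (ENNReal.mul_lt_mul ha hb) (not_lt.2 h2)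
    · rw [Real.volume_preimage_mul_left (by norm_num)]
      simp
  · have hof : 1 ≤ ENNReal.ofReal t := by simpa using ht1
    have hA : {x | ENNReal.ofReal t < f x} = ∅ := by
      ext x; simpa using (hfle x).trans hof
    have hB : {x | ENNReal.ofReal t < g x} = ∅ := by
      ext x; simpa using (hgle x).trans hof
    simp [hA, hB]

theorem ENNReal.mul_le_sq_of_add_le_two_mul {a b c : ℝ≥0∞} (h : a + b ≤ 2 * c) :
    a * b ≤ c ^ 2 := by
  by_cases hc : c = ⊤
  · simp [hc]
  have htop : a + b ≠ ⊤ := (h.trans_lt (ENNReal.mul_lt_top (by simp) (lt_top_iff_ne_top.2 hc))).ne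
  lift c to NNReal using hc
  lift a to NNReal using (ENNReal.add_ne_top.1 htop).1
  lift b to NNReal using (ENNReal.add_ne_top.1 htop).2
  norm_cast at h ⊢
  have h' : (a : ℝ) + b ≤ 2 * c := by exact_mod_cast h
  rw [← NNReal.coe_le_coe]
  push_cast
  nlinarith [sq_nonneg ((a : ℝ) - b), a.2, b.2, c.2, add_nonneg a.2 b.2]

theorem lintegral_mul_le_sq_of_bounded {f g H : ℝ → ℝ≥0∞} (hf : Measurable f)
    (hg : Measurable g) (hH : Measurable H) (hfb : ⨆ x, f x ≠ ⊤) (hgb : ⨆ x, g x ≠ ⊤)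
    (h : ∀ x y, f x * g y ≤ H ((x + y) / 2) ^ 2) :
    (∫⁻ x, f x) * ∫⁻ x, g x ≤ (∫⁻ x, H x) ^ 2 := by
  set M := ⨆ x, f x with hM
  set N := ⨆ x, g x with hN
  by_cases hM0 : M = 0
  · have : ∀ x, f x = 0 := by simpa [hM] using hM0
    simp [this]
  by_cases hN0 : N = 0
  · have : ∀ x, g x = 0 := by simpa [hN] using hN0
    simp [this]
  -- The geometric mean of the two suprema: dividing `f`, `g`, `H` by `M`, `N`, `c` preserves the
  -- hypothesis and makes the suprema `1`. AM–GM then turns the additive bound into the product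
  -- bound.
  set c : ℝ≥0∞ := (M * N) ^ (1 / 2 : ℝ) with hc
  have hc2 : c ^ 2 = M * N := by
    rw [hc, ← ENNReal.rpow_natCast, ← ENNReal.rpow_mul]
    norm_num
  have hMN0 : M * N ≠ 0 := mul_ne_zero hM0 hN0
  have hMNt : M * N ≠ ⊤ := ENNReal.mul_ne_top hfb hgb
  have key := lintegral_add_le_of_iSup_eq_one (f := fun x => M⁻¹ * f x) (g := fun x => N⁻¹ * g x)
    (H := fun x => c⁻¹ * H x) (hf.const_mul _) (hg.const_mul _) (hH.const_mul _)
    (by rw [← ENNReal.mul_iSup, ← hM, ENNReal.inv_mul_cancel hM0 hfb])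
    (by rw [← ENNReal.mul_iSup, ← hN, ENNReal.inv_mul_cancel hN0 hgb]) (by
      intro x y
      rw [mul_pow, ← ENNReal.inv_pow, hc2, ENNReal.mul_inv (Or.inl hM0) (Or.inl hfb),
        mul_mul_mul_comm]
      exact mul_le_mul' le_rfl (h x y))
  have key' := ENNReal.mul_le_sq_of_add_le_two_mul key
  rw [lintegral_const_mul _ hf, lintegral_const_mul _ hg, lintegral_const_mul _ hH, mul_pow,
    ← ENNReal.inv_pow, hc2, mul_mul_mul_comm, ← ENNReal.mul_inv (Or.inl hM0) (Or.inl hfb)] at key'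
  have := mul_le_mul' (le_refl (M * N)) key'
  simpa only [← mul_assoc, ENNReal.mul_inv_cancel hMN0 hMNt, one_mul] using this

theorem lintegral_eq_iSup_lintegral_min {f : ℝ → ℝ≥0∞} (hf : Measurable f) :
    ∫⁻ x, f x = ⨆ n : ℕ, ∫⁻ x, min (f x) n := by
  rw [← lintegral_iSup (fun n => hf.min measurable_const)]
  · refine lintegral_congr fun x => ?_
    have : ⨆ n : ℕ, f x ⊓ (n : ℝ≥0∞) = f x ⊓ ⨆ n : ℕ, (n : ℝ≥0∞) := (inf_iSup_eq _ _).symm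
    rw [ENNReal.iSup_natCast, inf_top_eq] at this
    exact this.symm
  · intro m n hmn x
    exact min_le_min le_rfl (by exact_mod_cast hmn)

theorem iSup_min_natCast_ne_top (f : ℝ → ℝ≥0∞) (n : ℕ) : ⨆ x, min (f x) n ≠ ⊤ :=
  ((iSup_le fun x => min_le_right (f x) (n : ℝ≥0∞)).trans_lt (ENNReal.natCast_lt_top n)).ne

/-- The midpoint Prékopa–Leindler inequality on the real line. -/
theorem lintegral_mul_le_sq_real {f g H : ℝ → ℝ≥0∞} (hf : Measurable f)
    (hg : Measurable g) (hH : Measurable H)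
    (h : ∀ x y, f x * g y ≤ H ((x + y) / 2) ^ 2) :
    (∫⁻ x, f x) * ∫⁻ x, g x ≤ (∫⁻ x, H x) ^ 2 := by
  -- Monotone convergence over the truncations of `f` and `g` removes the boundedness assumption.
  rw [lintegral_eq_iSup_lintegral_min hf, lintegral_eq_iSup_lintegral_min hg, ENNReal.iSup_mul]
  refine iSup_le fun m => ?_
  rw [ENNReal.mul_iSup]
  refine iSup_le fun n => ?_
  refine lintegral_mul_le_sq_of_bounded (hf.min measurable_const) (hg.min measurable_const) hH
    (iSup_min_natCast_ne_top f m) (iSup_min_natCast_ne_top g n) fun x y => ?_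
  exact (mul_le_mul' (min_le_left _ _) (min_le_left _ _)).trans (h x y)

/-- The midpoint Prékopa–Leindler inequality on `Fin n → ℝ`. -/
theorem lintegral_mul_le_sq_pi : ∀ (n : ℕ) {f g H : (Fin n → ℝ) → ℝ≥0∞}, Measurable f →
    Measurable g → Measurable H →
    (∀ x y, f x * g y ≤ H ((2⁻¹ : ℝ) • (x + y)) ^ 2) →
    (∫⁻ x, f x) * ∫⁻ x, g x ≤ (∫⁻ x, H x) ^ 2
  | 0, f, g, H, _, _, _, h => by
    have := h 0 0
    rw [smul_add, smul_zero, add_zero] at this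
    rw [lintegral_unique, lintegral_unique, lintegral_unique]
    simp only [volume_pi, Measure.pi_univ, Finset.univ_eq_empty, Finset.prod_empty, mul_one]
    have hd : ∀ F : (Fin 0 → ℝ) → ℝ≥0∞, ∀ x, F x = F 0 := fun F x =>
      congrArg F (Subsingleton.elim x 0)
    rwa [hd f, hd g, hd H]
  | n + 1, f, g, H, hf, hg, hH, h => by
    let e := MeasurableEquiv.piFinSuccAbove (fun _ : Fin (n + 1) => ℝ) 0
    have he : ∀ {F : (Fin (n + 1) → ℝ) → ℝ≥0∞}, Measurable F →
        ∫⁻ x, F x = ∫⁻ s, ∫⁻ y, F (e.symm (s, y)) := by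
      intro F hF
      rw [← ((volume_preserving_piFinSuccAbove (fun _ : Fin (n + 1) => ℝ) 0).symm e).lintegral_comp
        hF, Measure.volume_eq_prod, lintegral_prod]
      exact (hF.comp e.symm.measurable).aemeasurable
    have hmeas : ∀ {F : (Fin (n + 1) → ℝ) → ℝ≥0∞}, Measurable F →
        Measurable fun s => ∫⁻ y, F (e.symm (s, y)) := fun hF =>
      (hF.comp e.symm.measurable).lintegral_prod_right'
    have hsec : ∀ {F : (Fin (n + 1) → ℝ) → ℝ≥0∞}, Measurable F → ∀ s,
        Measurable fun y => F (e.symm (s, y)) := fun hF s =>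
      hF.comp (e.symm.measurable.comp measurable_prodMk_left)
    rw [he hf, he hg, he hH]
    -- The integrals over the last `n` coordinates satisfy the one-dimensional hypothesis, by
    -- induction applied to the slices at `s`, `t` and their midpoint.
    refine lintegral_mul_le_sq_real (hmeas hf) (hmeas hg) (hmeas hH) fun s t => ?_
    refine lintegral_mul_le_sq_pi n (hsec hf s) (hsec hg t) (hsec hH _) fun x y => ?_
    convert h (e.symm (s, x)) (e.symm (t, y)) using 3
    ext i
    refine Fin.cases ?_ (fun j => ?_) i
    · simp [e, MeasurableEquiv.piFinSuccAbove, div_eq_inv_mul]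
    · simp [e, MeasurableEquiv.piFinSuccAbove, mul_add]

/-- The midpoint Prékopa–Leindler inequality on Euclidean space. -/
theorem lintegral_mul_le_sq_euclideanSpace {d : ℕ} {f g H : EuclideanSpace ℝ (Fin d) → ℝ≥0∞}
    (hf : Measurable f) (hg : Measurable g) (hH : Measurable H)
    (h : ∀ x y, f x * g y ≤ H ((2⁻¹ : ℝ) • (x + y)) ^ 2) :
    (∫⁻ x, f x) * ∫⁻ x, g x ≤ (∫⁻ x, H x) ^ 2 := by
  have hmp := PiLp.volume_preserving_toLp (Fin d)
  rw [← hmp.lintegral_comp hf, ← hmp.lintegral_comp hg, ← hmp.lintegral_comp hH]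
  refine lintegral_mul_le_sq_pi d (hf.comp hmp.measurable) (hg.comp hmp.measurable)
    (hH.comp hmp.measurable) fun x y => ?_
  simpa using h (WithLp.toLp 2 x) (WithLp.toLp 2 y)

end PrekopaLeindler

/-! ### Exponential tilts: mass, mean and covariance. -/

noncomputable section ExponentialFamily

open scoped RealInnerProductSpace Topology

/-- If `c > 0`, then `ψ - (c/4) s²` still has second derivative `c/2 > 0` at `0`, hence a local
minimum there. Together with the maximum of `ψ` this gives `s² ≤ 0` near `0`. Without the quadratic
correction one would only learn that `ψ` is locally constant. -/
theorem le_zero_of_hasDerivAt_of_forall_le {ψ ψ' : ℝ → ℝ} {c : ℝ}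
    (hψ : ∀ s, HasDerivAt ψ (ψ' s) s) (hψ' : HasDerivAt ψ' c 0) (hmax : ∀ s, ψ s ≤ ψ 0) :
    c ≤ 0 := by
  by_contra! hc
  have h0 : ψ' 0 = 0 :=
    IsLocalMax.hasDerivAt_eq_zero (Filter.Eventually.of_forall hmax) (hψ 0)
  have h1 : ∀ s, HasDerivAt (fun s => ψ s - c / 4 * s ^ 2) (ψ' s - c / 2 * s) s := by
    intro s
    convert! (hψ s).sub ((hasDerivAt_pow 2 s).const_mul (c / 4)) using 1
    push_cast
    ring
  have hd : deriv (fun s => ψ s - c / 4 * s ^ 2) = fun s => ψ' s - c / 2 * s :=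
    funext fun s => (h1 s).deriv
  have h2 : HasDerivAt (fun s => ψ' s - c / 2 * s) (c - c / 2 * 1) 0 :=
    hψ'.sub ((hasDerivAt_id 0).const_mul (c / 2))
  have hmin : IsLocalMin (fun s => ψ s - c / 4 * s ^ 2) 0 := by
    refine isLocalMin_of_deriv_deriv_pos ?_ ?_ (h1 0).continuousAt
    · rw [hd, h2.deriv]
      linarith
    · rw [hd]
      simp [h0]
  have hev : ∀ᶠ s in 𝓝 (0 : ℝ), s = 0 := by
    filter_upwards [hmin] with s hs
    have := hmax s
    have hs2 : s ^ 2 ≤ 0 := by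
      by_contra! hpos
      nlinarith [mul_pos hc hpos]
    exact pow_eq_zero_iff (two_ne_zero) |>.1 (le_antisymm hs2 (sq_nonneg s))
  obtain ⟨ε, hε, hball⟩ := Metric.eventually_nhds_iff.1 hev
  have := hball (y := ε / 2) (by rw [Real.dist_eq, sub_zero, abs_of_pos (by linarith)]; linarith)
  linarith

variable {E : Type*} [NormedAddCommGroup E] [InnerProductSpace ℝ E] [FiniteDimensional ℝ E]
  [MeasurableSpace E] [BorelSpace E]
  {F : Type*} [NormedAddCommGroup F] [NormedSpace ℝ F]

/-- A positive continuous weight with Gaussian decay. -/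
structure IsGaussianWeight (k : E → ℝ) : Prop where
  continuous : Continuous k
  pos : ∀ x, 0 < k x
  decay : ∃ A b : ℝ, 0 < b ∧ ∀ x, k x ≤ A * Real.exp (-b * ‖x‖ ^ 2)

theorem integrable_exp_neg_mul_sq_norm {b : ℝ} (hb : 0 < b) :
    Integrable fun x : E => Real.exp (-b * ‖x‖ ^ 2) := by
  have := (GaussianFourier.integrable_cexp_neg_mul_sq_norm_add (V := E) (b := (b : ℂ))
    (by simpa using hb) 0 0).norm
  refine this.congr (Filter.Eventually.of_forall fun x => ?_)
  simp [Complex.norm_exp, ← Complex.ofReal_pow]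

namespace IsGaussianWeight

variable {k : E → ℝ}

theorem integrable_exp_norm_mul (hk : IsGaussianWeight k) (C : ℝ) :
    Integrable fun x => Real.exp (C * ‖x‖) * k x := by
  obtain ⟨A, b, hb, hA⟩ := hk.decay
  have hkc := hk.continuous
  refine ((integrable_exp_neg_mul_sq_norm (E := E) (half_pos hb)).const_mul
    (A * Real.exp (C ^ 2 / (2 * b)))).mono' (by fun_prop) (Filter.Eventually.of_forall fun x => ?_)
  have hA0 : 0 ≤ A := by
    have := (hk.pos 0).le.trans (hA 0)
    simpa using this
  rw [Real.norm_of_nonneg (mul_nonneg (Real.exp_nonneg _) (hk.pos x).le)]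
  calc Real.exp (C * ‖x‖) * k x ≤ Real.exp (C * ‖x‖) * (A * Real.exp (-b * ‖x‖ ^ 2)) := by
        gcongr; exact hA x
    _ = A * Real.exp (C * ‖x‖ + -b * ‖x‖ ^ 2) := by rw [Real.exp_add]; ring
    -- Half of the Gaussian decay absorbs the linear exponent, by completing the square.
    _ ≤ A * Real.exp (C ^ 2 / (2 * b) + -(b / 2) * ‖x‖ ^ 2) := by
        refine mul_le_mul_of_nonneg_left (Real.exp_le_exp.2 ?_) hA0
        have : C ^ 2 / (2 * b) + -(b / 2) * ‖x‖ ^ 2 - (C * ‖x‖ + -b * ‖x‖ ^ 2)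
            = (C - b * ‖x‖) ^ 2 / (2 * b) := by field_simp; ring
        have h2 : 0 ≤ (C - b * ‖x‖) ^ 2 / (2 * b) := by positivity
        linarith
    _ = _ := by rw [Real.exp_add]; ring

theorem integrable_tilt_smul (hk : IsGaussianWeight k) {G : E → F} (hG : Continuous G)
    {B C : ℝ} (hGB : ∀ x, ‖G x‖ ≤ B * Real.exp (C * ‖x‖)) (h : E) :
    Integrable fun x => (Real.exp ⟪h, x⟫ * k x) • G x := by
  have hkc := hk.continuous
  refine ((hk.integrable_exp_norm_mul (‖h‖ + C)).const_mul B).mono' (by fun_prop)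
    (Filter.Eventually.of_forall fun x => ?_)
  rw [norm_smul, Real.norm_of_nonneg (mul_nonneg (Real.exp_nonneg _) (hk.pos x).le)]
  calc Real.exp ⟪h, x⟫ * k x * ‖G x‖
      ≤ Real.exp (‖h‖ * ‖x‖) * k x * (B * Real.exp (C * ‖x‖)) := by
        have := hk.pos x
        gcongr
        · exact real_inner_le_norm h x
        · exact hGB x
    _ = B * (Real.exp ((‖h‖ + C) * ‖x‖) * k x) := by rw [add_mul, Real.exp_add]; ring

end IsGaussianWeight

/-- The integral of `G` against the exponential tilt of the weight `k`. -/
def tiltIntegral (k : E → ℝ) (G : E → F) (h : E) : F :=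
  ∫ x, (Real.exp ⟪h, x⟫ * k x) • G x

theorem norm_le_exp_norm {V : Type*} [NormedAddCommGroup V] (x : V) : ‖x‖ ≤ Real.exp ‖x‖ :=
  (le_add_of_nonneg_right zero_le_one).trans (Real.add_one_le_exp _)

namespace IsGaussianWeight

variable {k : E → ℝ}

theorem hasFDerivAt_tiltIntegral (hk : IsGaussianWeight k) {G : E → F} (hG : Continuous G)
    {B C : ℝ} (hGB : ∀ x, ‖G x‖ ≤ B * Real.exp (C * ‖x‖)) (h : E) :
    HasFDerivAt (tiltIntegral k G) (tiltIntegral k (fun x => (innerSL ℝ x).smulRight (G x)) h) h := by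
  have hkc := hk.continuous
  have hB : 0 ≤ B := by
    have := (norm_nonneg _).trans (hGB 0)
    simpa using this
  have hG' : Continuous fun x : E => (innerSL ℝ x).smulRight (G x) := by
    have : Continuous fun x : E => ContinuousLinearMap.smulRightL ℝ E F (innerSL ℝ x) (G x) := by
      fun_prop
    exact this
  refine hasFDerivAt_integral_of_dominated_of_fderiv_le
    (F' := fun h x => (Real.exp ⟪h, x⟫ * k x) • (innerSL ℝ x).smulRight (G x))
    -- Uniform over the unit ball around `h`: the tilt costs `‖h‖ + 1`, and one more `exp ‖x‖`
    -- absorbs the factor `‖x‖` produced by differentiation.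
    (bound := fun x => B * (Real.exp ((‖h‖ + 2 + C) * ‖x‖) * k x))
    (Metric.ball_mem_nhds h one_pos) ?_ (hk.integrable_tilt_smul hG hGB h) ?_ ?_
    ((hk.integrable_exp_norm_mul _).const_mul B) ?_
  · exact Filter.Eventually.of_forall fun h' =>
      (hk.integrable_tilt_smul hG hGB h').aestronglyMeasurable
  · have : Continuous fun x => (Real.exp ⟪h, x⟫ * k x) • (innerSL ℝ x).smulRight (G x) := by
      fun_prop
    exact this.aestronglyMeasurable
  · refine Filter.Eventually.of_forall fun x h' hh' => ?_
    have hh : ‖h'‖ ≤ ‖h‖ + 1 := by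
      have := norm_le_norm_add_norm_sub' h' h
      rw [Metric.mem_ball, dist_eq_norm] at hh'
      linarith
    have hkx := hk.pos x
    rw [norm_smul, Real.norm_of_nonneg (mul_nonneg (Real.exp_nonneg _) hkx.le),
      ContinuousLinearMap.norm_smulRight_apply, innerSL_apply_norm]
    calc Real.exp ⟪h', x⟫ * k x * (‖x‖ * ‖G x‖)
        ≤ Real.exp ((‖h‖ + 1) * ‖x‖) * k x * (Real.exp ‖x‖ * (B * Real.exp (C * ‖x‖))) := by
          gcongr
          · exact (real_inner_le_norm h' x).trans (by gcongr)
          · exact norm_le_exp_norm x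
          · exact hGB x
      _ = B * (Real.exp ((‖h‖ + 2 + C) * ‖x‖) * k x) := by
          rw [show (‖h‖ + 2 + C) * ‖x‖ = (‖h‖ + 1) * ‖x‖ + ‖x‖ + C * ‖x‖ by ring, Real.exp_add,
            Real.exp_add]
          ring
  · refine Filter.Eventually.of_forall fun x h' _ => ?_
    have h1 : HasFDerivAt (fun h : E => ⟪h, x⟫) (innerSL ℝ x) h' := by
      convert! (innerSL ℝ x).hasFDerivAt using 1
      ext y
      simp [real_inner_comm]
    convert! ((h1.exp.mul_const (k x)).smul_const (G x)) using 1
    ext y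
    simp only [smul_apply, ContinuousLinearMap.smulRight_apply, smul_eq_mul,
      smul_smul]
    congr 1
    ring

end IsGaussianWeight

/-- The total mass of the exponential tilt of `k`. -/
def tiltMass (k : E → ℝ) (h : E) : ℝ := ∫ x, Real.exp ⟪h, x⟫ * k x

/-- The mean of the exponential tilt of `k`. -/
def tiltMean (k : E → ℝ) (h : E) : E := (tiltMass k h)⁻¹ • tiltIntegral k id h

namespace IsGaussianWeight

variable {k : E → ℝ}

theorem integrable_tilt (hk : IsGaussianWeight k) (h : E) :
    Integrable fun x => Real.exp ⟪h, x⟫ * k x := by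
  simpa using hk.integrable_tilt_smul (G := fun _ => (1 : ℝ)) continuous_const (B := 1) (C := 0)
    (by simp) h

theorem integrable_tilt_id (hk : IsGaussianWeight k) (h : E) :
    Integrable fun x => (Real.exp ⟪h, x⟫ * k x) • x :=
  hk.integrable_tilt_smul continuous_id (B := 1) (C := 1)
    (fun x => by simpa using norm_le_exp_norm x) h

theorem integrable_tilt_inner (hk : IsGaussianWeight k) (h u : E) :
    Integrable fun x => Real.exp ⟪h, x⟫ * k x * ⟪x, u⟫ := by
  simpa [real_inner_smul_left] using (hk.integrable_tilt_id h).inner_const (𝕜 := ℝ) u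

theorem norm_innerSL_smulRight_le {V : Type*} [NormedAddCommGroup V] [InnerProductSpace ℝ V]
    (x : V) :
    ‖(innerSL ℝ x).smulRight x‖ ≤ 1 * Real.exp (2 * ‖x‖) := by
  rw [ContinuousLinearMap.norm_smulRight_apply, innerSL_apply_norm, one_mul, two_mul, Real.exp_add]
  gcongr <;> exact norm_le_exp_norm x

theorem integrable_tilt_smulRight (hk : IsGaussianWeight k) (h : E) :
    Integrable fun x => (Real.exp ⟪h, x⟫ * k x) • (innerSL ℝ x).smulRight x := by
  refine hk.integrable_tilt_smul ?_ norm_innerSL_smulRight_le h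
  have : Continuous fun x : E => ContinuousLinearMap.smulRightL ℝ E E (innerSL ℝ x) x := by
    fun_prop
  exact this

theorem integrable_tilt_inner_mul_inner (hk : IsGaussianWeight k) (h u w : E) :
    Integrable fun x => Real.exp ⟪h, x⟫ * k x * (⟪x, w⟫ * ⟪x, u⟫) := by
  simpa [real_inner_smul_left] using
    ((hk.integrable_tilt_smulRight h).apply_continuousLinearMap w).inner_const (𝕜 := ℝ) u

theorem tiltMass_pos (hk : IsGaussianWeight k) (h : E) : 0 < tiltMass k h := by
  have hkc := hk.continuous
  have hpos : ∀ x, 0 < Real.exp ⟪h, x⟫ * k x := fun x => mul_pos (Real.exp_pos _) (hk.pos x)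
  refine (integral_pos_iff_support_of_nonneg (fun x => (hpos x).le) (hk.integrable_tilt h)).2 ?_
  rw [show Function.support (fun x => Real.exp ⟪h, x⟫ * k x) = univ from
    eq_univ_of_forall fun x => (hpos x).ne']
  exact Measure.measure_univ_pos.2 (NeZero.ne _)

theorem hasFDerivAt_tiltMass (hk : IsGaussianWeight k) (h : E) :
    HasFDerivAt (tiltMass k) (innerSL ℝ (tiltIntegral k id h)) h := by
  have h1 := hk.hasFDerivAt_tiltIntegral (G := fun _ => (1 : ℝ)) continuous_const (B := 1) (C := 0)
    (by simp) h
  have h2 : tiltIntegral k (fun _ => (1 : ℝ)) = tiltMass k := by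
    ext h
    simp [tiltIntegral, tiltMass]
  rw [h2] at h1
  convert! h1 using 1
  have hL : tiltIntegral k (fun x : E => (innerSL ℝ x).smulRight (1 : ℝ)) h
      = ∫ x, innerSL ℝ ((Real.exp ⟪h, x⟫ * k x) • x) := by
    refine integral_congr_ae (Filter.Eventually.of_forall fun x => ?_)
    ext y
    simp
  rw [hL, (innerSL ℝ).integral_comp_comm (hk.integrable_tilt_id h)]
  rfl

theorem inner_tiltIntegral_id (hk : IsGaussianWeight k) (h u : E) :
    ⟪tiltIntegral k id h, u⟫ = ∫ x, Real.exp ⟪h, x⟫ * k x * ⟪x, u⟫ := by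
  simp only [tiltIntegral, id_eq]
  rw [real_inner_comm, ← integral_inner (hk.integrable_tilt_id h) u]
  refine integral_congr_ae (Filter.Eventually.of_forall fun x => ?_)
  simp [real_inner_smul_right, real_inner_comm]

theorem inner_tiltMean (hk : IsGaussianWeight k) (h u : E) :
    ∫ x, Real.exp ⟪h, x⟫ * k x * ⟪x, u⟫ = tiltMass k h * ⟪tiltMean k h, u⟫ := by
  rw [tiltMean, real_inner_smul_left, ← mul_assoc, mul_inv_cancel₀ (hk.tiltMass_pos h).ne', one_mul,
    hk.inner_tiltIntegral_id]

theorem integrable_tilt_cov (hk : IsGaussianWeight k) (h m u w : E) :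
    Integrable fun x => Real.exp ⟪h, x⟫ * k x * (⟪x - m, w⟫ * ⟪x - m, u⟫) := by
  have := (((hk.integrable_tilt_inner_mul_inner h u w).sub
    ((hk.integrable_tilt_inner h u).const_mul ⟪m, w⟫)).sub
    ((hk.integrable_tilt_inner h w).const_mul ⟪m, u⟫)).add
    ((hk.integrable_tilt h).const_mul (⟪m, w⟫ * ⟪m, u⟫))
  refine this.congr (Filter.Eventually.of_forall fun x => ?_)
  simp only [Pi.add_apply, Pi.sub_apply, inner_sub_left]
  ring

theorem integral_tilt_cov (hk : IsGaussianWeight k) (h u w : E) :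
    ∫ x, Real.exp ⟪h, x⟫ * k x * (⟪x - tiltMean k h, w⟫ * ⟪x - tiltMean k h, u⟫)
      = (∫ x, Real.exp ⟪h, x⟫ * k x * (⟪x, w⟫ * ⟪x, u⟫))
        - tiltMass k h * (⟪tiltMean k h, w⟫ * ⟪tiltMean k h, u⟫) := by
  set m := tiltMean k h with hm
  have i1 := hk.integrable_tilt_inner_mul_inner h u w
  have i2 := (hk.integrable_tilt_inner h u).const_mul ⟪m, w⟫
  have i3 := (hk.integrable_tilt_inner h w).const_mul ⟪m, u⟫
  have i4 := (hk.integrable_tilt h).const_mul (⟪m, w⟫ * ⟪m, u⟫)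
  have i12 : Integrable fun x => Real.exp ⟪h, x⟫ * k x * (⟪x, w⟫ * ⟪x, u⟫)
      - ⟪m, w⟫ * (Real.exp ⟪h, x⟫ * k x * ⟪x, u⟫) := i1.sub i2
  have i123 : Integrable fun x => Real.exp ⟪h, x⟫ * k x * (⟪x, w⟫ * ⟪x, u⟫)
      - ⟪m, w⟫ * (Real.exp ⟪h, x⟫ * k x * ⟪x, u⟫)
      - ⟪m, u⟫ * (Real.exp ⟪h, x⟫ * k x * ⟪x, w⟫) := i12.sub i3
  have : ∀ x, Real.exp ⟪h, x⟫ * k x * (⟪x - m, w⟫ * ⟪x - m, u⟫)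
      = Real.exp ⟪h, x⟫ * k x * (⟪x, w⟫ * ⟪x, u⟫) - ⟪m, w⟫ * (Real.exp ⟪h, x⟫ * k x * ⟪x, u⟫)
        - ⟪m, u⟫ * (Real.exp ⟪h, x⟫ * k x * ⟪x, w⟫)
        + ⟪m, w⟫ * ⟪m, u⟫ * (Real.exp ⟪h, x⟫ * k x) := by
    intro x
    simp only [inner_sub_left]
    ring
  simp_rw [this]
  rw [integral_add i123 i4, integral_sub i12 i3, integral_sub i1 i2,
    integral_const_mul, integral_const_mul, integral_const_mul, hk.inner_tiltMean,
    hk.inner_tiltMean, ← hm]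
  change _ = _ - (∫ x, Real.exp ⟪h, x⟫ * k x) * _
  rw [tiltMass]
  ring

/-- The derivative of the tilted mean is the covariance of the tilted law. -/
theorem exists_hasFDerivAt_tiltMean (hk : IsGaussianWeight k) (h : E) :
    ∃ T : E →L[ℝ] E, HasFDerivAt (tiltMean k) T h ∧ ∀ w u, ⟪T w, u⟫ = (tiltMass k h)⁻¹ *
      ∫ x, Real.exp ⟪h, x⟫ * k x * (⟪x - tiltMean k h, w⟫ * ⟪x - tiltMean k h, u⟫) := by
  have hZ := hk.hasFDerivAt_tiltMass h
  have hZ0 := (hk.tiltMass_pos h).ne'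
  have hL := hk.hasFDerivAt_tiltIntegral (G := id) continuous_id (B := 1) (C := 1)
    (fun x => by simpa using norm_le_exp_norm x) h
  have hinv := (hasDerivAt_inv hZ0).comp_hasFDerivAt h hZ
  -- Quotient rule: differentiating the inverse mass subtracts the product of the means from the
  -- second moment, leaving the covariance.
  refine ⟨_, hinv.smul hL, fun w u => ?_⟩
  have hLw : ⟪tiltIntegral k (fun x : E => (innerSL ℝ x).smulRight x) h w, u⟫
      = ∫ x, Real.exp ⟪h, x⟫ * k x * (⟪x, w⟫ * ⟪x, u⟫) := by
    have hi := hk.integrable_tilt_smulRight h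
    rw [tiltIntegral, ContinuousLinearMap.integral_apply hi, real_inner_comm,
      ← integral_inner (hi.apply_continuousLinearMap w) u]
    refine integral_congr_ae (Filter.Eventually.of_forall fun x => ?_)
    simp [real_inner_smul_right, real_inner_comm]
  rw [hk.integral_tilt_cov, mul_sub, ← mul_assoc, inv_mul_cancel₀ hZ0, one_mul, ← hLw]
  simp only [add_apply, smul_apply,
    ContinuousLinearMap.smulRight_apply, inner_add_left, real_inner_smul_left, tiltMean,
    smul_eq_mul, innerSL_apply_apply, id_eq, Function.comp_apply]
  field_simp
  ring

theorem cov_pos (hk : IsGaussianWeight k) (h m : E) {u : E} (hu : u ≠ 0) :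
    0 < ∫ x, Real.exp ⟪h, x⟫ * k x * (⟪x - m, u⟫ * ⟪x - m, u⟫) := by
  have hkc := hk.continuous
  have hnn : ∀ x, 0 ≤ Real.exp ⟪h, x⟫ * k x * (⟪x - m, u⟫ * ⟪x - m, u⟫) := fun x =>
    mul_nonneg (mul_nonneg (Real.exp_nonneg _) (hk.pos x).le) (mul_self_nonneg _)
  refine lt_of_le_of_ne (integral_nonneg hnn) fun h0 => ?_
  have hae := (integral_eq_zero_iff_of_nonneg hnn (hk.integrable_tilt_cov h m u u)).1 h0.symm
  have hc : Continuous fun x => Real.exp ⟪h, x⟫ * k x * (⟪x - m, u⟫ * ⟪x - m, u⟫) := by fun_prop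
  -- A continuous nonnegative integrand with zero integral vanishes everywhere, but at `m + u` this
  -- one is positive.
  have := congrFun ((hc.ae_eq_iff_eq volume continuous_zero).1 hae) (m + u)
  have hpos : 0 < Real.exp ⟪h, m + u⟫ * k (m + u) * (⟪m + u - m, u⟫ * ⟪m + u - m, u⟫) := by
    have h1 : 0 < ⟪u, u⟫ := real_inner_self_pos.2 hu
    rw [add_sub_cancel_left]
    exact mul_pos (mul_pos (Real.exp_pos _) (hk.pos _)) (mul_pos h1 h1)
  exact hpos.ne' this

end IsGaussianWeight

/-! ### Covariance bound from strong log-concavity. -/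

section StronglyLogConcave

variable {d : ℕ} {k : EuclideanSpace ℝ (Fin d) → ℝ}

/-- Prékopa–Leindler for the tilts by `h + u` and `h - u`. The mismatch `⟪u, x - y⟫` is absorbed by
the strong log-concavity gain, since `‖u‖ r ≤ ‖u‖²/c + (c/4) r²`. -/
theorem IsGaussianWeight.tiltMass_mul_tiltMass_le (hk : IsGaussianWeight k) {c : ℝ} (hc : 0 < c)
    (hmid : ∀ x y, k x * k y ≤ k ((2⁻¹ : ℝ) • (x + y)) ^ 2 * Real.exp (-(c / 4) * ‖x - y‖ ^ 2))
    (h u : EuclideanSpace ℝ (Fin d)) :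
    tiltMass k (h + u) * tiltMass k (h - u) ≤ Real.exp (‖u‖ ^ 2 / c) * tiltMass k h ^ 2 := by
  have hkc := hk.continuous
  have hkp := hk.pos
  -- Half the final exponent, because `H` enters squared.
  set a := Real.exp (‖u‖ ^ 2 / (2 * c)) with ha
  have hnn : ∀ h x, 0 ≤ Real.exp ⟪h, x⟫ * k x := fun h x =>
    mul_nonneg (Real.exp_nonneg _) (hk.pos x).le
  have key := lintegral_mul_le_sq_euclideanSpace
    (f := fun x => ENNReal.ofReal (Real.exp ⟪h + u, x⟫ * k x))
    (g := fun x => ENNReal.ofReal (Real.exp ⟪h - u, x⟫ * k x))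
    (H := fun x => ENNReal.ofReal (a * (Real.exp ⟪h, x⟫ * k x)))
    (by fun_prop) (by fun_prop) (by fun_prop) (by
      intro x y
      have hm := hkp ((2⁻¹ : ℝ) • (x + y))
      rw [← ENNReal.ofReal_mul (hnn _ _), ← ENNReal.ofReal_pow
        (mul_nonneg (Real.exp_nonneg _) (hnn _ _))]
      refine ENNReal.ofReal_le_ofReal ?_
      calc Real.exp ⟪h + u, x⟫ * k x * (Real.exp ⟪h - u, y⟫ * k y)
          = Real.exp (⟪h + u, x⟫ + ⟪h - u, y⟫) * (k x * k y) := by rw [Real.exp_add]; ring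
        _ ≤ Real.exp (⟪h + u, x⟫ + ⟪h - u, y⟫) *
            (k ((2⁻¹ : ℝ) • (x + y)) ^ 2 * Real.exp (-(c / 4) * ‖x - y‖ ^ 2)) := by
            exact mul_le_mul_of_nonneg_left (hmid x y) (Real.exp_nonneg _)
        _ = Real.exp (⟪h + u, x⟫ + ⟪h - u, y⟫ + -(c / 4) * ‖x - y‖ ^ 2) *
            k ((2⁻¹ : ℝ) • (x + y)) ^ 2 := by rw [Real.exp_add _ (-(c / 4) * ‖x - y‖ ^ 2)]; ring
        _ ≤ Real.exp (‖u‖ ^ 2 / c + ⟪h, x + y⟫) * k ((2⁻¹ : ℝ) • (x + y)) ^ 2 := by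
            refine mul_le_mul_of_nonneg_right (Real.exp_le_exp.2 ?_) (sq_nonneg _)
            have h1 : ⟪h + u, x⟫ + ⟪h - u, y⟫ = ⟪h, x + y⟫ + ⟪u, x - y⟫ := by
              simp only [inner_add_left, inner_sub_left, inner_add_right, inner_sub_right]; ring
            have h2 := real_inner_le_norm u (x - y)
            have h3 : ‖u‖ ^ 2 / c - ‖u‖ * ‖x - y‖ + (c / 4) * ‖x - y‖ ^ 2
                = (‖u‖ - c / 2 * ‖x - y‖) ^ 2 / c := by field_simp; ring
            have h4 : 0 ≤ (‖u‖ - c / 2 * ‖x - y‖) ^ 2 / c := by positivity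
            linarith
        _ = (a * (Real.exp ⟪h, (2⁻¹ : ℝ) • (x + y)⟫ * k ((2⁻¹ : ℝ) • (x + y)))) ^ 2 := by
            rw [mul_pow, mul_pow, ha, ← Real.exp_nat_mul, ← Real.exp_nat_mul, ← mul_assoc,
              ← Real.exp_add, real_inner_smul_right]
            congr 2
            push_cast
            field_simp)
  rw [← ofReal_integral_eq_lintegral_ofReal (hk.integrable_tilt _)
      (Filter.Eventually.of_forall (hnn _)),
    ← ofReal_integral_eq_lintegral_ofReal (hk.integrable_tilt _)
      (Filter.Eventually.of_forall (hnn _)),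
    ← ofReal_integral_eq_lintegral_ofReal ((hk.integrable_tilt _).const_mul _)
      (Filter.Eventually.of_forall fun x => mul_nonneg (Real.exp_nonneg _) (hnn _ _)),
    integral_const_mul, ← ENNReal.ofReal_mul (integral_nonneg (hnn _)), ← ENNReal.ofReal_pow
      (mul_nonneg (Real.exp_nonneg _) (integral_nonneg (hnn _)))] at key
  have key' := (ENNReal.ofReal_le_ofReal_iff (sq_nonneg _)).1 key
  refine key'.trans_eq ?_
  rw [mul_pow, ← Real.exp_nat_mul]
  congr 2
  push_cast
  field_simp

/-- The Brascamp–Lieb bound for linear functions: a `c`-strongly log-concave weight has tilted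
covariances bounded by `c⁻¹`. -/
theorem IsGaussianWeight.fderiv_tiltMean_le (hk : IsGaussianWeight k) {c : ℝ} (hc : 0 < c)
    (hmid : ∀ x y, k x * k y ≤ k ((2⁻¹ : ℝ) • (x + y)) ^ 2 * Real.exp (-(c / 4) * ‖x - y‖ ^ 2))
    {h : EuclideanSpace ℝ (Fin d)} {T : EuclideanSpace ℝ (Fin d) →L[ℝ] EuclideanSpace ℝ (Fin d)}
    (hT : HasFDerivAt (tiltMean k) T h) (u : EuclideanSpace ℝ (Fin d)) :
    ⟪T u, u⟫ ≤ ‖u‖ ^ 2 / c := by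
  have hline : ∀ s : ℝ, HasDerivAt (fun s : ℝ => h + s • u) u s := fun s => by
    simpa using ((hasDerivAt_id s).smul_const u).const_add h
  have hline' : ∀ s : ℝ, HasDerivAt (fun s : ℝ => h - s • u) (-u) s := fun s => by
    simpa using ((hasDerivAt_id s).smul_const u).const_sub h
  have hlog : ∀ (g : ℝ → EuclideanSpace ℝ (Fin d)) (g' : EuclideanSpace ℝ (Fin d)) (s : ℝ),
      HasDerivAt g g' s →
      HasDerivAt (fun s => Real.log (tiltMass k (g s))) ⟪tiltMean k (g s), g'⟫ s := by
    intro g g' s hg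
    have h1 := (hk.hasFDerivAt_tiltMass (g s)).comp_hasDerivAt s hg
    have h2 := h1.log (hk.tiltMass_pos (g s)).ne'
    convert! h2 using 1
    simp [tiltMean, real_inner_smul_left, div_eq_inv_mul]
  have hT0 : HasFDerivAt (tiltMean k) T (h + (0 : ℝ) • u) := by simpa using hT
  have hT0' : HasFDerivAt (tiltMean k) T (h - (0 : ℝ) • u) := by simpa using hT
  have hinner : ∀ w : EuclideanSpace ℝ (Fin d), ∀ {m : ℝ → EuclideanSpace ℝ (Fin d)}
      {m' : EuclideanSpace ℝ (Fin d)}, HasDerivAt m m' 0 →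
      HasDerivAt (fun s => ⟪m s, w⟫) ⟪m', w⟫ 0 := by
    intro w m m' hm
    simpa using hm.inner ℝ (hasDerivAt_const (0 : ℝ) w)
  -- The mass inequality with `s • u` says exactly that this `ψ` is maximal at `0`. Its second
  -- derivative there is `2 ⟪T u, u⟫ - 2 ‖u‖²/c`.
  have hle := le_zero_of_hasDerivAt_of_forall_le
    (ψ := fun s => Real.log (tiltMass k (h + s • u)) + Real.log (tiltMass k (h - s • u))
      - ‖u‖ ^ 2 / c * s ^ 2)
    (ψ' := fun s => ⟪tiltMean k (h + s • u), u⟫ + ⟪tiltMean k (h - s • u), -u⟫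
      - 2 * (‖u‖ ^ 2 / c) * s)
    (c := ⟪T u, u⟫ + ⟪T (-u), -u⟫ - 2 * (‖u‖ ^ 2 / c))
    (fun s => by
      convert! ((hlog _ _ s (hline s)).add (hlog _ _ s (hline' s))).sub
        ((hasDerivAt_pow 2 s).const_mul (‖u‖ ^ 2 / c)) using 1
      push_cast
      ring)
    (by
      convert! ((hinner u (hT0.comp_hasDerivAt 0 (hline 0))).add
        (hinner (-u) (hT0'.comp_hasDerivAt 0 (hline' 0)))).sub
        ((hasDerivAt_id (0 : ℝ)).const_mul (2 * (‖u‖ ^ 2 / c))) using 1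
      simp)
    (fun s => by
      have h1 := hk.tiltMass_pos (h + s • u)
      have h2 := hk.tiltMass_pos (h - s • u)
      have h3 := hk.tiltMass_pos h
      have h4 := Real.log_le_log (mul_pos h1 h2) (hk.tiltMass_mul_tiltMass_le hc hmid h (s • u))
      rw [Real.log_mul h1.ne' h2.ne', Real.log_mul (Real.exp_pos _).ne' (pow_pos h3 2).ne',
        Real.log_exp, Real.log_pow, norm_smul, mul_pow, Real.norm_eq_abs, sq_abs] at h4
      simp only [zero_smul, add_zero, sub_zero]
      push_cast at h4
      have : s ^ 2 * ‖u‖ ^ 2 / c = ‖u‖ ^ 2 / c * s ^ 2 := by ring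
      linarith)
  rw [map_neg, inner_neg_neg] at hle
  linarith

end StronglyLogConcave

end ExponentialFamily

/-! ### From the Hessian bound to midpoint convexity and Gaussian decay. -/

noncomputable section StrongConvexity

open scoped RealInnerProductSpace Topology

variable {d : ℕ}

theorem EuclideanSpace.eq_sum_smul_single (u : EuclideanSpace ℝ (Fin d)) :
    u = ∑ i, u i • EuclideanSpace.single i (1 : ℝ) := by
  simpa using ((EuclideanSpace.basisFun (Fin d) ℝ).sum_repr u).symm

/-- The matrix of a continuous linear endomorphism of Euclidean space. -/
def euclideanMatrix (A : EuclideanSpace ℝ (Fin d) →L[ℝ] EuclideanSpace ℝ (Fin d)) :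
    Matrix (Fin d) (Fin d) ℝ :=
  fun i j => A (EuclideanSpace.single j 1) i

theorem isHermitian_euclideanMatrix
    {A : EuclideanSpace ℝ (Fin d) →L[ℝ] EuclideanSpace ℝ (Fin d)}
    (hsymm : ∀ u w, ⟪A u, w⟫ = ⟪A w, u⟫) : (euclideanMatrix A).IsHermitian := by
  ext i j
  have := hsymm (EuclideanSpace.single i 1) (EuclideanSpace.single j 1)
  simpa [euclideanMatrix, EuclideanSpace.inner_single_right] using this

theorem dotProduct_euclideanMatrix_mulVec
    (A : EuclideanSpace ℝ (Fin d) →L[ℝ] EuclideanSpace ℝ (Fin d)) (x : Fin d → ℝ) :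
    star x ⬝ᵥ (euclideanMatrix A).mulVec x = ⟪A (WithLp.toLp 2 x), WithLp.toLp 2 x⟫ := by
  conv_rhs => rw [EuclideanSpace.eq_sum_smul_single (WithLp.toLp 2 x), map_sum,
    ← EuclideanSpace.eq_sum_smul_single]
  simp [PiLp.inner_apply, dotProduct, Matrix.mulVec, euclideanMatrix, mul_comm]

theorem posSemidef_euclideanMatrix
    {A : EuclideanSpace ℝ (Fin d) →L[ℝ] EuclideanSpace ℝ (Fin d)}
    (hsymm : ∀ u w, ⟪A u, w⟫ = ⟪A w, u⟫) (hnn : ∀ u, 0 ≤ ⟪A u, u⟫) :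
    (euclideanMatrix A).PosSemidef := by
  refine .of_dotProduct_mulVec_nonneg (isHermitian_euclideanMatrix hsymm) fun x => ?_
  rw [dotProduct_euclideanMatrix_mulVec]
  exact hnn _

theorem posDef_euclideanMatrix
    {A : EuclideanSpace ℝ (Fin d) →L[ℝ] EuclideanSpace ℝ (Fin d)}
    (hsymm : ∀ u w, ⟪A u, w⟫ = ⟪A w, u⟫) (hpos : ∀ u, u ≠ 0 → 0 < ⟪A u, u⟫) :
    (euclideanMatrix A).PosDef := by
  refine .of_dotProduct_mulVec_pos (isHermitian_euclideanMatrix hsymm) fun x hx => ?_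
  rw [dotProduct_euclideanMatrix_mulVec]
  exact hpos _ (by simpa using hx)

theorem StronglyLogConcavePotential.le_fderiv_fderiv {γ : ℝ} {Φ : EuclideanSpace ℝ (Fin d) → ℝ}
    (hΦ : StronglyLogConcavePotential γ Φ) (x u : EuclideanSpace ℝ (Fin d)) :
    γ * ‖u‖ ^ 2 ≤ fderiv ℝ (fderiv ℝ Φ) x u u := by
  have h := (hΦ.hessian_ge x).dotProduct_mulVec_nonneg (WithLp.ofLp u)
  have h1 : WithLp.ofLp u ⬝ᵥ (hessianMatrix Φ x).mulVec (WithLp.ofLp u)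
      = fderiv ℝ (fderiv ℝ Φ) x u u := by
    conv_rhs => rw [EuclideanSpace.eq_sum_smul_single u]
    simp only [map_sum, sum_apply, map_smul, smul_apply,
      dotProduct, Matrix.mulVec, hessianMatrix, iteratedFDeriv_two_apply, Finset.mul_sum,
      smul_eq_mul, Matrix.cons_val_zero, Matrix.cons_val_one]
    rw [Finset.sum_comm]
    refine Finset.sum_congr rfl fun i _ => Finset.sum_congr rfl fun j _ => by ring
  have h2 : WithLp.ofLp u ⬝ᵥ WithLp.ofLp u = ‖u‖ ^ 2 := by
    rw [EuclideanSpace.real_norm_sq_eq]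
    simp [dotProduct, sq]
  rw [star_trivial, Matrix.sub_mulVec, dotProduct_sub, h1, Matrix.smul_mulVec, Matrix.one_mulVec,
    dotProduct_smul, h2, smul_eq_mul] at h
  linarith

theorem StronglyLogConcavePotential.hasDerivAt_line {γ : ℝ} {Φ : EuclideanSpace ℝ (Fin d) → ℝ}
    (hΦ : StronglyLogConcavePotential γ Φ) (m u : EuclideanSpace ℝ (Fin d)) (s : ℝ) :
    HasDerivAt (fun s : ℝ => Φ (m + s • u) - γ / 2 * ‖u‖ ^ 2 * s ^ 2)
      (fderiv ℝ Φ (m + s • u) u - γ * ‖u‖ ^ 2 * s) s := by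
  have hline : HasDerivAt (fun s : ℝ => m + s • u) u s := by
    simpa using ((hasDerivAt_id s).smul_const u).const_add m
  have h1 : HasFDerivAt Φ (fderiv ℝ Φ (m + s • u)) (m + s • u) :=
    (hΦ.contDiff.differentiable (by norm_num) _).hasFDerivAt
  convert! (h1.comp_hasDerivAt s hline).sub
    ((hasDerivAt_pow 2 s).const_mul (γ / 2 * ‖u‖ ^ 2)) using 1
  push_cast
  ring

/-- Restriction to lines reduces the matrix inequality to a nonnegative second derivative. The
midpoint and tangent inequalities for `Φ` are both read off from it. -/
theorem StronglyLogConcavePotential.convexOn_line {γ : ℝ} {Φ : EuclideanSpace ℝ (Fin d) → ℝ}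
    (hΦ : StronglyLogConcavePotential γ Φ) (m u : EuclideanSpace ℝ (Fin d)) :
    ConvexOn ℝ univ (fun s : ℝ => Φ (m + s • u) - γ / 2 * ‖u‖ ^ 2 * s ^ 2) := by
  have hd := hΦ.hasDerivAt_line m u
  have hd' : deriv (fun s : ℝ => Φ (m + s • u) - γ / 2 * ‖u‖ ^ 2 * s ^ 2)
      = fun s => fderiv ℝ Φ (m + s • u) u - γ * ‖u‖ ^ 2 * s := funext fun s => (hd s).deriv
  have hd2 : ∀ s : ℝ, HasDerivAt (fun s => fderiv ℝ Φ (m + s • u) u - γ * ‖u‖ ^ 2 * s)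
      (fderiv ℝ (fderiv ℝ Φ) (m + s • u) u u - γ * ‖u‖ ^ 2) s := by
    intro s
    have hline : HasDerivAt (fun s : ℝ => m + s • u) u s := by
      simpa using ((hasDerivAt_id s).smul_const u).const_add m
    have h1 : HasFDerivAt (fderiv ℝ Φ) (fderiv ℝ (fderiv ℝ Φ) (m + s • u)) (m + s • u) :=
      ((hΦ.contDiff.fderiv_right (m := 1) (by norm_num)).differentiable (by norm_num) _).hasFDerivAt
    have h2 : HasDerivAt (fun s : ℝ => fderiv ℝ Φ (m + s • u))
        (fderiv ℝ (fderiv ℝ Φ) (m + s • u) u) s := h1.comp_hasDerivAt s hline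
    have h3 : HasDerivAt (fun s : ℝ => fderiv ℝ Φ (m + s • u) u)
        (fderiv ℝ (fderiv ℝ Φ) (m + s • u) u u) s :=
      (ContinuousLinearMap.apply ℝ ℝ u).hasFDerivAt.comp_hasDerivAt s h2
    have h4 : HasDerivAt (fun s : ℝ => γ * ‖u‖ ^ 2 * s) (γ * ‖u‖ ^ 2) s := by
      simpa using (hasDerivAt_id s).const_mul (γ * ‖u‖ ^ 2)
    exact h3.sub h4
  refine convexOn_univ_of_deriv2_nonneg (fun s => (hd s).differentiableAt) ?_ fun s => ?_
  · rw [hd']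
    exact fun s => (hd2 s).differentiableAt
  · rw [Function.iterate_succ, Function.iterate_one, Function.comp_apply, hd', (hd2 s).deriv]
    linarith [hΦ.le_fderiv_fderiv (m + s • u) u]

theorem StronglyLogConcavePotential.midpoint_le {γ : ℝ} {Φ : EuclideanSpace ℝ (Fin d) → ℝ}
    (hΦ : StronglyLogConcavePotential γ Φ) (x y : EuclideanSpace ℝ (Fin d)) :
    2 * Φ ((2⁻¹ : ℝ) • (x + y)) + γ / 4 * ‖x - y‖ ^ 2 ≤ Φ x + Φ y := by
  -- Centred at the midpoint with half the difference as direction, the endpoints are `s = 1` and `s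
  -- = -1`.
  have h := (hΦ.convexOn_line ((2⁻¹ : ℝ) • (x + y)) ((2⁻¹ : ℝ) • (x - y))).2
    (mem_univ (1 : ℝ)) (mem_univ (-1 : ℝ)) (by norm_num : (0 : ℝ) ≤ 1 / 2)
    (by norm_num : (0 : ℝ) ≤ 1 / 2) (by norm_num)
  have e1 : (2⁻¹ : ℝ) • (x + y) + (1 : ℝ) • (2⁻¹ : ℝ) • (x - y) = x := by module
  have e2 : (2⁻¹ : ℝ) • (x + y) + (-1 : ℝ) • (2⁻¹ : ℝ) • (x - y) = y := by module
  have e3 : (1 / 2 : ℝ) • x + (1 / 2 : ℝ) • y = (2⁻¹ : ℝ) • (x + y) := by module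
  simp only [e1, e2, norm_smul, smul_eq_mul, mul_pow] at h
  norm_num at h
  rw [e3] at h
  linarith

theorem StronglyLogConcavePotential.le_apply {γ : ℝ} {Φ : EuclideanSpace ℝ (Fin d) → ℝ}
    (hΦ : StronglyLogConcavePotential γ Φ) (x : EuclideanSpace ℝ (Fin d)) :
    Φ 0 + fderiv ℝ Φ 0 x + γ / 2 * ‖x‖ ^ 2 ≤ Φ x := by
  have h := (hΦ.convexOn_line 0 x).le_slope_of_hasDerivAt (mem_univ 0) (mem_univ 1) zero_lt_one
    (hΦ.hasDerivAt_line 0 x 0)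
  simp [slope_def_field] at h
  linarith

/-- The posterior weight `exp (-Φ x - q ‖x‖² / 2)`. -/
def posteriorWeight (Φ : EuclideanSpace ℝ (Fin d) → ℝ) (q : ℝ) (x : EuclideanSpace ℝ (Fin d)) : ℝ :=
  Real.exp (-Φ x - q / 2 * ‖x‖ ^ 2)

theorem StronglyLogConcavePotential.isGaussianWeight {γ : ℝ} {Φ : EuclideanSpace ℝ (Fin d) → ℝ}
    (hΦ : StronglyLogConcavePotential γ Φ) (hγ : 0 < γ) {q : ℝ} (hq : 0 ≤ q) :
    IsGaussianWeight (posteriorWeight Φ q) where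
  continuous := by
    have := hΦ.contDiff.continuous
    unfold posteriorWeight
    fun_prop
  pos x := Real.exp_pos _
  decay := by
    -- Half of the quadratic growth `γ/2` absorbs the linear term at the origin, leaving the rate
    -- `γ/4`; the `q` term only helps.
    refine ⟨Real.exp (-Φ 0 + ‖fderiv ℝ Φ 0‖ ^ 2 / γ), γ / 4, by positivity, fun x => ?_⟩
    rw [← Real.exp_add, posteriorWeight, Real.exp_le_exp]
    have h1 := hΦ.le_apply x
    have h2 : -(‖fderiv ℝ Φ 0‖ * ‖x‖) ≤ fderiv ℝ Φ 0 x :=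
      neg_le_of_abs_le ((fderiv ℝ Φ 0).le_opNorm x)
    have h3 : ‖fderiv ℝ Φ 0‖ ^ 2 / γ - ‖fderiv ℝ Φ 0‖ * ‖x‖ + γ / 4 * ‖x‖ ^ 2
        = (‖fderiv ℝ Φ 0‖ - γ / 2 * ‖x‖) ^ 2 / γ := by field_simp; ring
    have h4 : 0 ≤ (‖fderiv ℝ Φ 0‖ - γ / 2 * ‖x‖) ^ 2 / γ := by positivity
    have h5 : 0 ≤ q / 2 * ‖x‖ ^ 2 := by positivity
    linarith

/-- The parallelogram law makes the quadratic term contribute exactly `q` to the convexity constant,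
in addition to the `γ` from `Φ`. -/
theorem StronglyLogConcavePotential.posteriorWeight_mul_le {γ : ℝ}
    {Φ : EuclideanSpace ℝ (Fin d) → ℝ} (hΦ : StronglyLogConcavePotential γ Φ) (q : ℝ)
    (x y : EuclideanSpace ℝ (Fin d)) :
    posteriorWeight Φ q x * posteriorWeight Φ q y ≤
      posteriorWeight Φ q ((2⁻¹ : ℝ) • (x + y)) ^ 2 * Real.exp (-((γ + q) / 4) * ‖x - y‖ ^ 2) := by
  simp only [posteriorWeight]
  rw [← Real.exp_add, ← Real.exp_nat_mul, ← Real.exp_add, Real.exp_le_exp]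
  have h1 := hΦ.midpoint_le x y
  have h2 := parallelogram_law_with_norm ℝ x y
  rw [norm_smul, mul_pow]
  have h3 : ‖(2⁻¹ : ℝ)‖ ^ 2 = 1 / 4 := by norm_num
  rw [h3]
  push_cast
  linear_combination h1 + q / 4 * h2

end StrongConvexity

/-! ### Joint law of `z_t` and `z₀`. -/

noncomputable section JointLaw

open scoped RealInnerProductSpace Topology

/-- Both measures have the same characteristic function. Only positivity of the normalising constant
matters later, so it is left as an inverse integral. -/
theorem exists_stdGaussian_eq_withDensity {E : Type*} [NormedAddCommGroup E]
    [InnerProductSpace ℝ E] [FiniteDimensional ℝ E] [MeasurableSpace E] [BorelSpace E] :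
    ∃ κ : ℝ, 0 < κ ∧ stdGaussian E =
      volume.withDensity fun x : E => ENNReal.ofReal (κ * Real.exp (-‖x‖ ^ 2 / 2)) := by
  have hint : Integrable fun x : E => Real.exp (-‖x‖ ^ 2 / 2) := by
    refine (integrable_exp_neg_mul_sq_norm (E := E) (b := 1 / 2) (by norm_num)).congr
      (Filter.Eventually.of_forall fun x => ?_)
    change Real.exp _ = Real.exp _
    congr 1
    ring
  set I := ∫ x : E, Real.exp (-‖x‖ ^ 2 / 2) with hI
  have hIpos : 0 < I := integral_exp_pos hint
  refine ⟨I⁻¹, inv_pos.2 hIpos, ?_⟩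
  have : IsFiniteMeasure (volume.withDensity fun x : E =>
      ENNReal.ofReal (I⁻¹ * Real.exp (-‖x‖ ^ 2 / 2))) :=
    isFiniteMeasure_withDensity_ofReal (hint.const_mul _).2
  have hfourier : ∀ t : E, ∫ x : E, (Real.exp (-‖x‖ ^ 2 / 2) : ℂ) * Complex.exp (⟪x, t⟫ * Complex.I)
      = I * Complex.exp (-‖t‖ ^ 2 / 2) := by
    have hg : ∀ t : E, ∫ x : E, (Real.exp (-‖x‖ ^ 2 / 2) : ℂ) * Complex.exp (⟪x, t⟫ * Complex.I)
        = (Real.pi / (1 / 2 : ℂ)) ^ (Module.finrank ℝ E / 2 : ℂ)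
          * Complex.exp (-‖t‖ ^ 2 / 2) := by
      intro t
      have h := GaussianFourier.integral_cexp_neg_mul_sq_norm_add (V := E) (b := 1 / 2)
        (by norm_num) Complex.I t
      have e1 : Complex.I ^ 2 * (‖t‖ : ℂ) ^ 2 / (4 * (1 / 2)) = -‖t‖ ^ 2 / 2 := by
        rw [Complex.I_sq]; ring
      rw [e1] at h
      rw [← h]
      refine integral_congr_ae (Filter.Eventually.of_forall fun x => ?_)
      simp only [Complex.ofReal_exp]
      rw [← Complex.exp_add, real_inner_comm]
      congr 1
      push_cast
      ring
    intro t
    rw [hg t]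
    -- Evaluation at `t = 0` identifies the explicit Fourier constant with `I`.
    have h0 := hg 0
    simp only [inner_zero_right, Complex.ofReal_zero, zero_mul, Complex.exp_zero, mul_one,
      norm_zero, ne_eq, OfNat.ofNat_ne_zero, not_false_eq_true, zero_pow, neg_zero, zero_div] at h0
    rw [← h0, hI, ← integral_complex_ofReal]
  refine Measure.ext_of_charFun (funext fun t => ?_)
  rw [charFun_stdGaussian, charFun_apply, integral_withDensity_eq_integral_toReal_smul
    (by fun_prop) (by simp)]
  have : ∀ x : E, (ENNReal.ofReal (I⁻¹ * Real.exp (-‖x‖ ^ 2 / 2))).toReal •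
      Complex.exp (⟪x, t⟫ * Complex.I)
      = (I⁻¹ : ℂ) * ((Real.exp (-‖x‖ ^ 2 / 2) : ℂ) * Complex.exp (⟪x, t⟫ * Complex.I)) := by
    intro x
    rw [ENNReal.toReal_ofReal (by positivity), Complex.real_smul]
    push_cast
    ring
  simp_rw [this]
  rw [integral_const_mul, hfourier t, ← mul_assoc, inv_mul_cancel₀ (by exact_mod_cast hIpos.ne'),
    one_mul]

theorem map_withDensity_comp {X Y : Type*} [MeasurableSpace X] [MeasurableSpace Y]
    (ν : Measure X) {S : X → Y} (hS : Measurable S) {f : Y → ENNReal} (hf : Measurable f) :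
    (ν.withDensity (f ∘ S)).map S = (ν.map S).withDensity f := by
  ext B hB
  rw [Measure.map_apply hS hB, withDensity_apply _ (hS hB), withDensity_apply _ hB,
    setLIntegral_map hB hf hS]
  rfl

/-- The change of variables `(x, y) ↦ (a x + s y, x)` rescales Lebesgue measure. -/
theorem exists_map_interpolation_eq {E : Type*} [NormedAddCommGroup E]
    [InnerProductSpace ℝ E] [FiniteDimensional ℝ E] [MeasurableSpace E] [BorelSpace E]
    (a : ℝ) {s : ℝ} (hs : 0 < s) :
    ∃ κ : ℝ, 0 < κ ∧
      ((volume : Measure E).prod (volume : Measure E)).map (fun p => (a • p.1 + s • p.2, p.1))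
        = ENNReal.ofReal κ • (volume : Measure E).prod (volume : Measure E) := by
  refine ⟨|(s ^ Module.finrank ℝ E)⁻¹|, by positivity, ?_⟩
  set κ := |(s ^ Module.finrank ℝ E)⁻¹|
  have hfib : ∀ x : E, (volume : Measure E).map (fun y => a • x + s • y)
      = ENNReal.ofReal κ • (volume : Measure E) := by
    intro x
    have h1 : (fun y : E => a • x + s • y) = (fun y => a • x + y) ∘ (fun y => s • y) := rfl
    rw [h1, ← Measure.map_map (by fun_prop) (by fun_prop), Measure.map_addHaar_smul _ hs.ne',
      Measure.map_smul, map_add_left_eq_self]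
  -- For fixed `x` the map in `y` is a dilation by `s` and a translation, so `a = 0` is allowed. The
  -- skew product puts the fibre second, hence the swap that follows.
  have hskew := (MeasurePreserving.id (volume : Measure E)).skew_product
    (g := fun x y => a • x + s • y) (μc := (volume : Measure E))
    (μd := ENNReal.ofReal κ • (volume : Measure E)) (by fun_prop)
    (Filter.Eventually.of_forall hfib)
  have hcomp := (Measure.measurePreserving_swap (μ := (volume : Measure E))
    (ν := ENNReal.ofReal κ • (volume : Measure E))).comp hskew
  rw [← Measure.prod_smul_left]
  exact hcomp.map_eq

variable {d : ℕ}

/-- The joint density of `(z_t, z₀)`. -/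
def jointDensity (Φ : EuclideanSpace ℝ (Fin d) → ℝ) (a s κ : ℝ)
    (p : EuclideanSpace ℝ (Fin d) × EuclideanSpace ℝ (Fin d)) : ℝ :=
  κ * Real.exp (-‖p.1‖ ^ 2 / (2 * s ^ 2)) *
    (Real.exp ⟪(a / s ^ 2) • p.1, p.2⟫ * posteriorWeight Φ (a ^ 2 / s ^ 2) p.2)

/-- With `z = a x + s y`, expanding `‖z - a x‖² / (2 s²)` separates a factor in `z` alone, the tilt
`⟪(a/s²) z, x⟫` and the quadratic term `(a²/s²) ‖x‖² / 2` of the posterior weight. -/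
theorem jointDensity_comp {Φ : EuclideanSpace ℝ (Fin d) → ℝ} {a s κ : ℝ} (hs : 0 < s)
    (x y : EuclideanSpace ℝ (Fin d)) :
    jointDensity Φ a s κ (a • x + s • y, x)
      = Real.exp (-Φ x) * (κ * Real.exp (-‖y‖ ^ 2 / 2)) := by
  simp only [jointDensity, posteriorWeight]
  rw [mul_left_comm (Real.exp (-Φ x)), mul_assoc, ← Real.exp_add, ← Real.exp_add, ← Real.exp_add]
  congr 2
  rw [real_inner_smul_left, inner_add_left, real_inner_smul_left, real_inner_smul_left,
    real_inner_self_eq_norm_sq, norm_add_sq_real, norm_smul, norm_smul, real_inner_smul_left,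
    real_inner_smul_right, mul_pow, mul_pow, Real.norm_eq_abs, Real.norm_eq_abs, sq_abs, sq_abs,
    real_inner_comm]
  field_simp
  ring

variable {Ω : Type*} [MeasurableSpace Ω] {μ : Measure Ω} [IsProbabilityMeasure μ]
  {Φ : EuclideanSpace ℝ (Fin d) → ℝ} {Z₀ Z₁ : Ω → EuclideanSpace ℝ (Fin d)}

theorem exists_map_interpolant_eq_withDensity (hΦ : Continuous Φ)
    (hZ₀ : Measurable Z₀) (hZ₁ : Measurable Z₁) (hlaw₀ : μ.map Z₀ = densityMeasure Φ)
    (hlaw₁ : μ.map Z₁ = stdGaussian (EuclideanSpace ℝ (Fin d))) (hindep : IndepFun Z₀ Z₁ μ)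
    (a : ℝ) {s : ℝ} (hs : 0 < s) :
    ∃ κ : ℝ, 0 < κ ∧ μ.map (fun ω => (a • Z₀ ω + s • Z₁ ω, Z₀ ω))
      = (volume.prod volume).withDensity fun p => ENNReal.ofReal (jointDensity Φ a s κ p) := by
  obtain ⟨κ₁, hκ₁, hG⟩ := exists_stdGaussian_eq_withDensity (E := EuclideanSpace ℝ (Fin d))
  obtain ⟨κ₂, hκ₂, hmap⟩ := exists_map_interpolation_eq (E := EuclideanSpace ℝ (Fin d)) a hs
  refine ⟨κ₂ * κ₁, mul_pos hκ₂ hκ₁, ?_⟩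
  have hjm : ∀ κ, Measurable fun p => ENNReal.ofReal (jointDensity Φ a s κ p) := by
    intro κ
    unfold jointDensity posteriorWeight
    fun_prop
  have hS : Measurable fun p : EuclideanSpace ℝ (Fin d) × EuclideanSpace ℝ (Fin d) =>
      (a • p.1 + s • p.2, p.1) := by fun_prop
  have h01 : μ.map (fun ω => (Z₀ ω, Z₁ ω)) = (volume.prod volume).withDensity
      ((fun p => ENNReal.ofReal (jointDensity Φ a s κ₁ p)) ∘
        fun p => (a • p.1 + s • p.2, p.1)) := by
    rw [(indepFun_iff_map_prod_eq_prod_map_map hZ₀.aemeasurable hZ₁.aemeasurable).1 hindep, hlaw₀,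
      hlaw₁, hG, densityMeasure, prod_withDensity (by fun_prop) (by fun_prop)]
    congr 1
    ext p
    rw [Function.comp_apply, jointDensity_comp hs, ENNReal.ofReal_mul (Real.exp_nonneg _)]
  have hcomp : (fun ω => (a • Z₀ ω + s • Z₁ ω, Z₀ ω))
      = (fun p : EuclideanSpace ℝ (Fin d) × EuclideanSpace ℝ (Fin d) =>
        (a • p.1 + s • p.2, p.1)) ∘ fun ω => (Z₀ ω, Z₁ ω) := rfl
  rw [hcomp, ← Measure.map_map hS (hZ₀.prodMk hZ₁), h01, map_withDensity_comp _ hS (hjm _), hmap,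
    withDensity_smul_measure, ← withDensity_smul _ (hjm _)]
  congr 1
  ext p
  rw [Pi.smul_apply, smul_eq_mul, ← ENNReal.ofReal_mul hκ₂.le]
  congr 1
  simp only [jointDensity]
  ring

end JointLaw

/-! ### The velocity field as the continuous conditional expectation. -/

noncomputable section VelocityField

open scoped RealInnerProductSpace Topology

variable {d : ℕ} {Ω : Type*} [MeasurableSpace Ω] {μ : Measure Ω}
  {Φ : EuclideanSpace ℝ (Fin d) → ℝ} {Z₀ Z₁ : Ω → EuclideanSpace ℝ (Fin d)}

theorem StronglyLogConcavePotential.integrable_of_map_eq {γ : ℝ}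
    (hΦ : StronglyLogConcavePotential γ Φ) (hγ : 0 < γ) (hZ₀ : Measurable Z₀)
    (hlaw₀ : μ.map Z₀ = densityMeasure Φ) : Integrable Z₀ μ := by
  have hc := hΦ.contDiff.continuous
  have h : Integrable id (μ.map Z₀) := by
    rw [hlaw₀, densityMeasure, integrable_withDensity_iff_integrable_smul' (by fun_prop) (by simp)]
    refine ((hΦ.isGaussianWeight hγ le_rfl).integrable_tilt_id 0).congr
      (Filter.Eventually.of_forall fun x => ?_)
    simp [posteriorWeight, ENNReal.toReal_ofReal (Real.exp_nonneg _)]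
  exact h.comp_measurable hZ₀

theorem integrable_of_map_eq_stdGaussian (hZ₁ : Measurable Z₁)
    (hlaw₁ : μ.map Z₁ = stdGaussian (EuclideanSpace ℝ (Fin d))) : Integrable Z₁ μ := by
  have h : Integrable id (μ.map Z₁) := by
    rw [hlaw₁]
    exact IsGaussian.integrable_id
  exact h.comp_measurable hZ₁

variable [IsProbabilityMeasure μ]

theorem IsGaussianWeight.continuous_tiltMean {k : EuclideanSpace ℝ (Fin d) → ℝ}
    (hk : IsGaussianWeight k) : Continuous (tiltMean k) :=
  continuous_iff_continuousAt.2 fun h =>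
    (hk.exists_hasFDerivAt_tiltMean h).choose_spec.1.continuousAt

theorem IsGaussianWeight.tiltMass_smul_tiltMean {k : EuclideanSpace ℝ (Fin d) → ℝ}
    (hk : IsGaussianWeight k) (h : EuclideanSpace ℝ (Fin d)) :
    tiltMass k h • tiltMean k h = tiltIntegral k id h := by
  rw [tiltMean, smul_smul, mul_inv_cancel₀ (hk.tiltMass_pos h).ne', one_smul]

/-- The posterior mean `E[z₀ | a z₀ + s z₁ = z]`. -/
def posteriorMean (Φ : EuclideanSpace ℝ (Fin d) → ℝ) (a s : ℝ) (z : EuclideanSpace ℝ (Fin d)) :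
    EuclideanSpace ℝ (Fin d) :=
  tiltMean (posteriorWeight Φ (a ^ 2 / s ^ 2)) ((a / s ^ 2) • z)

theorem jointDensity_pos (Φ : EuclideanSpace ℝ (Fin d) → ℝ) (a s : ℝ) {κ : ℝ} (hκ : 0 < κ)
    (p : EuclideanSpace ℝ (Fin d) × EuclideanSpace ℝ (Fin d)) : 0 < jointDensity Φ a s κ p := by
  simp only [jointDensity, posteriorWeight]
  positivity

theorem continuous_jointDensity (hΦ : Continuous Φ) (a s κ : ℝ) :
    Continuous (jointDensity Φ a s κ) := by
  unfold jointDensity posteriorWeight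
  fun_prop

namespace StronglyLogConcavePotential

variable {γ : ℝ}

theorem continuous_posteriorMean (hΦ : StronglyLogConcavePotential γ Φ) (hγ : 0 < γ) (a s : ℝ) :
    Continuous (posteriorMean Φ a s) :=
  (hΦ.isGaussianWeight hγ (by positivity)).continuous_tiltMean.comp (by fun_prop)

/-- Bayes' formula on each fibre, multiplied through by the marginal density so that no division
occurs. -/
theorem integral_jointDensity_smul (hΦ : StronglyLogConcavePotential γ Φ) (hγ : 0 < γ)
    (a s κ : ℝ) (z : EuclideanSpace ℝ (Fin d)) :
    ∫ x, jointDensity Φ a s κ (z, x) • posteriorMean Φ a s z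
      = ∫ x, jointDensity Φ a s κ (z, x) • x := by
  have hk := hΦ.isGaussianWeight hγ (q := a ^ 2 / s ^ 2) (by positivity)
  have h1 : ∫ x, jointDensity Φ a s κ (z, x) = κ * Real.exp (-‖z‖ ^ 2 / (2 * s ^ 2)) *
      tiltMass (posteriorWeight Φ (a ^ 2 / s ^ 2)) ((a / s ^ 2) • z) := by
    simp only [jointDensity]
    rw [integral_const_mul]
    rfl
  have h2 : ∫ x, jointDensity Φ a s κ (z, x) • x = (κ * Real.exp (-‖z‖ ^ 2 / (2 * s ^ 2))) •
      tiltIntegral (posteriorWeight Φ (a ^ 2 / s ^ 2)) id ((a / s ^ 2) • z) := by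
    simp only [jointDensity, mul_smul (κ * Real.exp _)]
    rw [integral_smul]
    rfl
  rw [integral_smul_const, h1, h2, ← hk.tiltMass_smul_tiltMean, smul_smul]
  rfl

/-- Averaging over a fibre does not increase the norm: on each fibre the integral of the norm is `‖∫
j x‖ ≤ ∫ ‖j x‖`, and the right side is integrable in `z`. -/
theorem integrable_jointDensity_smul_posteriorMean (hΦ : StronglyLogConcavePotential γ Φ)
    (hγ : 0 < γ) (a s : ℝ) {κ : ℝ} (hκ : 0 < κ)
    (hint : Integrable (fun p => jointDensity Φ a s κ p • p.2) (volume.prod volume)) :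
    Integrable (fun p => jointDensity Φ a s κ p • posteriorMean Φ a s p.1)
      (volume.prod volume) := by
  have hk := hΦ.isGaussianWeight hγ (q := a ^ 2 / s ^ 2) (by positivity)
  have hm := hΦ.continuous_posteriorMean hγ a s
  have hj := continuous_jointDensity hΦ.contDiff.continuous a s κ
  have hnn : ∀ p, 0 ≤ jointDensity Φ a s κ p := fun p => (jointDensity_pos Φ a s hκ p).le
  have hc : Continuous fun p : EuclideanSpace ℝ (Fin d) × EuclideanSpace ℝ (Fin d) =>
      jointDensity Φ a s κ p • posteriorMean Φ a s p.1 := by fun_prop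
  refine (integrable_prod_iff hc.aestronglyMeasurable).2 ⟨Filter.Eventually.of_forall fun z => ?_, ?_⟩
  · have h1 : Integrable fun x => jointDensity Φ a s κ (z, x) :=
      (hk.integrable_tilt ((a / s ^ 2) • z)).const_mul
        (κ * Real.exp (-‖z‖ ^ 2 / (2 * s ^ 2)))
    exact h1.smul_const (posteriorMean Φ a s z)
  · refine hint.integral_norm_prod_left.mono' ?_ (Filter.Eventually.of_forall fun z => ?_)
    · exact hc.norm.stronglyMeasurable.integral_prod_right'.aestronglyMeasurable
    · have h1 : ∫ x, ‖jointDensity Φ a s κ (z, x) • posteriorMean Φ a s z‖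
          = ‖∫ x, jointDensity Φ a s κ (z, x) • posteriorMean Φ a s z‖ := by
        simp only [norm_smul, Real.norm_of_nonneg (hnn _)]
        rw [integral_smul_const, norm_smul, Real.norm_of_nonneg (integral_nonneg fun x => hnn _),
          integral_mul_const]
      rw [Real.norm_of_nonneg (integral_nonneg fun x => norm_nonneg _), h1,
        hΦ.integral_jointDensity_smul hγ]
      exact norm_integral_le_integral_norm _

/-- The defining property of conditional expectation on the events `z_t ∈ B`: both sides become
iterated integrals against the joint density, which agree fibre by fibre. -/
theorem setIntegral_posteriorMean (hΦ : StronglyLogConcavePotential γ Φ) (hγ : 0 < γ)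
    (hZ₀ : Measurable Z₀) (hZ₁ : Measurable Z₁) (hlaw₀ : μ.map Z₀ = densityMeasure Φ)
    (hlaw₁ : μ.map Z₁ = stdGaussian (EuclideanSpace ℝ (Fin d))) (hindep : IndepFun Z₀ Z₁ μ)
    (a : ℝ) {s : ℝ} (hs : 0 < s) :
    Integrable (fun ω => posteriorMean Φ a s (a • Z₀ ω + s • Z₁ ω)) μ ∧
      ∀ B, MeasurableSet B →
        ∫ ω in (fun ω => a • Z₀ ω + s • Z₁ ω) ⁻¹' B, posteriorMean Φ a s (a • Z₀ ω + s • Z₁ ω) ∂μ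
          = ∫ ω in (fun ω => a • Z₀ ω + s • Z₁ ω) ⁻¹' B, Z₀ ω ∂μ := by
  obtain ⟨κ, hκ, hJ⟩ := exists_map_interpolant_eq_withDensity hΦ.contDiff.continuous hZ₀ hZ₁ hlaw₀
    hlaw₁ hindep a hs
  have hm := hΦ.continuous_posteriorMean hγ a s
  have hj := continuous_jointDensity hΦ.contDiff.continuous a s κ
  have hjm : Measurable fun p => ENNReal.ofReal (jointDensity Φ a s κ p) := by fun_prop
  have hnn : ∀ p, 0 ≤ jointDensity Φ a s κ p := fun p => (jointDensity_pos Φ a s hκ p).le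
  have hpair : Measurable fun ω => (a • Z₀ ω + s • Z₁ ω, Z₀ ω) := by fun_prop
  have hiff : ∀ F : EuclideanSpace ℝ (Fin d) × EuclideanSpace ℝ (Fin d) → EuclideanSpace ℝ (Fin d),
      Continuous F → (Integrable (fun ω => F (a • Z₀ ω + s • Z₁ ω, Z₀ ω)) μ ↔
        Integrable (fun p => jointDensity Φ a s κ p • F p) (volume.prod volume)) := by
    intro F hF
    have h1 := integrable_map_measure (μ := μ) (g := F) hF.aestronglyMeasurable hpair.aemeasurable
    rw [hJ, integrable_withDensity_iff_integrable_smul' hjm (by simp)] at h1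
    simp only [ENNReal.toReal_ofReal (hnn _)] at h1
    exact h1.symm
  have hset : ∀ F : EuclideanSpace ℝ (Fin d) × EuclideanSpace ℝ (Fin d) → EuclideanSpace ℝ (Fin d),
      Continuous F → Integrable (fun p => jointDensity Φ a s κ p • F p) (volume.prod volume) →
      ∀ B, MeasurableSet B →
      ∫ ω in (fun ω => a • Z₀ ω + s • Z₁ ω) ⁻¹' B, F (a • Z₀ ω + s • Z₁ ω, Z₀ ω) ∂μ
        = ∫ z in B, ∫ x, jointDensity Φ a s κ (z, x) • F (z, x) := by
    intro F hF hFi B hB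
    have h1 := setIntegral_map (μ := μ) (s := B ×ˢ univ) (f := F) (hB.prod MeasurableSet.univ)
      hF.aestronglyMeasurable hpair.aemeasurable
    rw [hJ, setIntegral_withDensity_eq_setIntegral_toReal_smul hjm (by simp) _
      (hB.prod MeasurableSet.univ)] at h1
    simp only [ENNReal.toReal_ofReal (hnn _)] at h1
    rw [setIntegral_prod _ hFi.integrableOn, Measure.restrict_univ] at h1
    rw [h1]
    congr 2
    ext ω
    simp
  have hi₀ := (hiff Prod.snd continuous_snd).1 (hΦ.integrable_of_map_eq hγ hZ₀ hlaw₀)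
  have him := hΦ.integrable_jointDensity_smul_posteriorMean hγ a s hκ hi₀
  have hmc : Continuous fun p : EuclideanSpace ℝ (Fin d) × EuclideanSpace ℝ (Fin d) =>
    posteriorMean Φ a s p.1 := hm.comp continuous_fst
  refine ⟨(hiff _ hmc).2 him, fun B hB => ?_⟩
  rw [hset _ hmc him B hB, hset _ continuous_snd hi₀ B hB]
  simp only [hΦ.integral_jointDensity_smul hγ]

/-- The joint density is strictly positive, so a null set `N` of the law of `z_t` gives a
Lebesgue-null cylinder `N ×ˢ univ`, and hence `N` itself is null. -/
theorem volume_absolutelyContinuous_map (hΦ : StronglyLogConcavePotential γ Φ)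
    (hZ₀ : Measurable Z₀) (hZ₁ : Measurable Z₁) (hlaw₀ : μ.map Z₀ = densityMeasure Φ)
    (hlaw₁ : μ.map Z₁ = stdGaussian (EuclideanSpace ℝ (Fin d))) (hindep : IndepFun Z₀ Z₁ μ)
    (a : ℝ) {s : ℝ} (hs : 0 < s) :
    volume ≪ μ.map fun ω => a • Z₀ ω + s • Z₁ ω := by
  obtain ⟨κ, hκ, hJ⟩ := exists_map_interpolant_eq_withDensity hΦ.contDiff.continuous hZ₀ hZ₁ hlaw₀
    hlaw₁ hindep a hs
  have hj := continuous_jointDensity hΦ.contDiff.continuous a s κ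
  have hac : (volume : Measure (EuclideanSpace ℝ (Fin d))).prod volume ≪
      μ.map fun ω => (a • Z₀ ω + s • Z₁ ω, Z₀ ω) := by
    rw [hJ]
    refine withDensity_absolutelyContinuous' (by fun_prop) (Filter.Eventually.of_forall fun p => ?_)
    simpa using jointDensity_pos Φ a s hκ p
  refine Measure.AbsolutelyContinuous.mk fun N hN hN0 => ?_
  rw [Measure.map_apply (by fun_prop) hN] at hN0
  have h0 := @hac (N ×ˢ univ) (by
    rw [Measure.map_apply (by fun_prop) (hN.prod MeasurableSet.univ)]
    convert hN0 using 2
    ext ω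
    simp)
  rw [Measure.prod_prod, mul_eq_zero] at h0
  exact h0.resolve_right (NeZero.ne _)

theorem posteriorMean_ae_eq_condExp (hΦ : StronglyLogConcavePotential γ Φ) (hγ : 0 < γ)
    (hZ₀ : Measurable Z₀) (hZ₁ : Measurable Z₁) (hlaw₀ : μ.map Z₀ = densityMeasure Φ)
    (hlaw₁ : μ.map Z₁ = stdGaussian (EuclideanSpace ℝ (Fin d))) (hindep : IndepFun Z₀ Z₁ μ)
    (a : ℝ) {s : ℝ} (hs : 0 < s) {Y : Ω → EuclideanSpace ℝ (Fin d)}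
    (hY : Y = fun ω => a • Z₀ ω + s • Z₁ ω) (b c : ℝ) :
    (fun ω => b • Y ω + c • posteriorMean Φ a s (Y ω)) =ᵐ[μ]
      μ[fun ω => b • Y ω + c • Z₀ ω | MeasurableSpace.comap Y inferInstance] := by
  have hm := hΦ.continuous_posteriorMean hγ a s
  have hi₀ := hΦ.integrable_of_map_eq hγ hZ₀ hlaw₀
  have hi₁ := integrable_of_map_eq_stdGaussian hZ₁ hlaw₁
  obtain ⟨him, hset⟩ := hΦ.setIntegral_posteriorMean hγ hZ₀ hZ₁ hlaw₀ hlaw₁ hindep a hs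
  have hYm : Measurable Y := by
    rw [hY]
    fun_prop
  have hiY : Integrable (fun ω => b • Y ω) μ := by
    rw [hY]
    exact ((hi₀.smul a).add (hi₁.smul s)).smul b
  have hi₀' : Integrable (fun ω => c • Z₀ ω) μ := hi₀.smul c
  have him' : Integrable (fun ω => c • posteriorMean Φ a s (Y ω)) μ := by
    rw [hY]
    exact him.smul c
  have hvc : Continuous fun z => b • z + c • posteriorMean Φ a s z := by fun_prop
  refine ae_eq_condExp_of_forall_setIntegral_eq hYm.comap_le (hiY.add hi₀') ?_ ?_ ?_
  · intro S _ _
    exact (hiY.add him').integrableOn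
  · rintro S ⟨B, hB, rfl⟩ -
    rw [integral_add hiY.integrableOn him'.integrableOn,
      integral_add hiY.integrableOn hi₀'.integrableOn, integral_smul c, integral_smul c]
    congr 2
    subst hY
    exact hset B hB
  · exact (hvc.stronglyMeasurable.comp_measurable (comap_measurable Y)).aestronglyMeasurable

theorem isVelocityFieldAt (hΦ : StronglyLogConcavePotential γ Φ) (hγ : 0 < γ)
    (hZ₀ : Measurable Z₀) (hZ₁ : Measurable Z₁) (hlaw₀ : μ.map Z₀ = densityMeasure Φ)
    (hlaw₁ : μ.map Z₁ = stdGaussian (EuclideanSpace ℝ (Fin d))) (hindep : IndepFun Z₀ Z₁ μ)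
    (α σ : ℝ → ℝ) {t : ℝ} (hσ : 0 < σ t) :
    IsVelocityFieldAt μ α σ Z₀ Z₁ t fun z => (timeDeriv σ t / σ t) • z
      + (timeDeriv α t - timeDeriv σ t * α t / σ t) • posteriorMean Φ (α t) (σ t) z := by
  have hm := hΦ.continuous_posteriorMean hγ (α t) (σ t)
  refine ⟨by fun_prop, ?_⟩
  -- Substituting `z₁ = (z_t - α z₀) / σ` leaves `z₀` as the only term not measurable with respect
  -- to `z_t`.
  have hdecomp : (fun ω => timeDeriv α t • Z₀ ω + timeDeriv σ t • Z₁ ω)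
      = fun ω => (timeDeriv σ t / σ t) • interpolant α σ Z₀ Z₁ t ω
        + (timeDeriv α t - timeDeriv σ t * α t / σ t) • Z₀ ω := by
    ext1 ω
    simp only [interpolant, smul_add, smul_smul, sub_smul]
    rw [div_mul_cancel₀ _ hσ.ne', div_mul_eq_mul_div]
    module
  rw [hdecomp]
  exact hΦ.posteriorMean_ae_eq_condExp hγ hZ₀ hZ₁ hlaw₀ hlaw₁ hindep (α t) hσ rfl _ _

/-- Two versions agree almost everywhere for the law of `z_t`, hence Lebesgue-almost everywhere,
hence everywhere by continuity. -/
theorem isVelocityFieldAt_unique (hΦ : StronglyLogConcavePotential γ Φ)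
    (hZ₀ : Measurable Z₀) (hZ₁ : Measurable Z₁) (hlaw₀ : μ.map Z₀ = densityMeasure Φ)
    (hlaw₁ : μ.map Z₁ = stdGaussian (EuclideanSpace ℝ (Fin d))) (hindep : IndepFun Z₀ Z₁ μ)
    {α σ : ℝ → ℝ} {t : ℝ} (hσ : 0 < σ t) {v w : EuclideanSpace ℝ (Fin d) → EuclideanSpace ℝ (Fin d)}
    (hv : IsVelocityFieldAt μ α σ Z₀ Z₁ t v) (hw : IsVelocityFieldAt μ α σ Z₀ Z₁ t w) : v = w := by
  have hvc := hv.continuous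
  have hwc := hw.continuous
  have h := hv.ae_eq_condExp.trans hw.ae_eq_condExp.symm
  have hac := hΦ.volume_absolutelyContinuous_map hZ₀ hZ₁ hlaw₀ hlaw₁ hindep (α t) hσ
  refine (hvc.ae_eq_iff_eq volume hwc).1 (hac.ae_le ?_)
  exact (ae_map_iff (by fun_prop) (measurableSet_eq_fun hvc.measurable hwc.measurable)).2 h

end StronglyLogConcavePotential

end VelocityField

/-! ### Rates and Jacobian bounds. -/

noncomputable section JacobianBounds

open scoped RealInnerProductSpace Topology

variable {d : ℕ}

theorem uniqueDiffWithinAt_Icc_zero_one {t : ℝ} (ht : t ∈ Ioc (0 : ℝ) 1) :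
    UniqueDiffWithinAt ℝ (Icc (0 : ℝ) 1) t :=
  uniqueDiffOn_Icc zero_lt_one t (Ioc_subset_Icc_self ht)

theorem upperRate_eq {σ : ℝ → ℝ} {t : ℝ} (ht : t ∈ Ioc (0 : ℝ) 1)
    (hσd : DifferentiableWithinAt ℝ σ (Icc 0 1) t) (hσ : 0 < σ t) :
    upperRate σ t = timeDeriv σ t / σ t :=
  (hσd.hasDerivWithinAt.log hσ.ne').derivWithin (uniqueDiffWithinAt_Icc_zero_one ht)

/-- In this form the lower rate is the value the Jacobian takes when the posterior covariance
attains its upper bound `(γ + α²/σ²)⁻¹`. -/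
theorem lowerRate_eq {γ : ℝ} (hγ : 0 < γ) {α σ : ℝ → ℝ} {t : ℝ} (ht : t ∈ Ioc (0 : ℝ) 1)
    (hαd : DifferentiableWithinAt ℝ α (Icc 0 1) t)
    (hσd : DifferentiableWithinAt ℝ σ (Icc 0 1) t) (hσ : 0 < σ t) :
    lowerRate γ α σ t =
      timeDeriv σ t / σ t + covCoeff α σ t / (γ + α t ^ 2 / σ t ^ 2) := by
  have hpos : 0 < α t ^ 2 + γ * σ t ^ 2 := by positivity
  have h := (((hαd.hasDerivWithinAt.pow 2).add ((hσd.hasDerivWithinAt.pow 2).const_mul γ)).log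
    hpos.ne').const_mul (1 / 2)
  have h' : lowerRate γ α σ t = _ := h.derivWithin (uniqueDiffWithinAt_Icc_zero_one ht)
  rw [h', covCoeff]
  change _ = derivWithin σ (Icc 0 1) t / σ t + (derivWithin α (Icc 0 1) t
    - derivWithin σ (Icc 0 1) t * α t / σ t) * (α t / σ t ^ 2) / _
  have hpos' : γ * σ t ^ 2 + α t ^ 2 ≠ 0 := by positivity
  simp only [Pi.add_apply, Pi.pow_apply]
  field_simp
  push_cast
  ring

theorem jacobianMatrix_sub_smul_one {v : EuclideanSpace ℝ (Fin d) → EuclideanSpace ℝ (Fin d)}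
    {z : EuclideanSpace ℝ (Fin d)} {A : EuclideanSpace ℝ (Fin d) →L[ℝ] EuclideanSpace ℝ (Fin d)}
    (h : HasFDerivAt v A z) (c : ℝ) :
    jacobianMatrix v z - c • (1 : Matrix (Fin d) (Fin d) ℝ)
      = euclideanMatrix (A - c • ContinuousLinearMap.id ℝ (EuclideanSpace ℝ (Fin d))) := by
  ext i j
  simp [jacobianMatrix, euclideanMatrix, h.fderiv, Matrix.one_apply]

theorem smul_one_sub_jacobianMatrix {v : EuclideanSpace ℝ (Fin d) → EuclideanSpace ℝ (Fin d)}
    {z : EuclideanSpace ℝ (Fin d)} {A : EuclideanSpace ℝ (Fin d) →L[ℝ] EuclideanSpace ℝ (Fin d)}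
    (h : HasFDerivAt v A z) (c : ℝ) :
    c • (1 : Matrix (Fin d) (Fin d) ℝ) - jacobianMatrix v z
      = euclideanMatrix (c • ContinuousLinearMap.id ℝ (EuclideanSpace ℝ (Fin d)) - A) := by
  ext i j
  simp [jacobianMatrix, euclideanMatrix, h.fderiv, Matrix.one_apply]

/-- The derivative of the posterior mean is a rescaled posterior covariance, which is positive
definite and bounded by the inverse of the posterior convexity constant. -/
theorem StronglyLogConcavePotential.exists_hasFDerivAt_posteriorMean {γ : ℝ}
    {Φ : EuclideanSpace ℝ (Fin d) → ℝ} (hΦ : StronglyLogConcavePotential γ Φ) (hγ : 0 < γ)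
    (a s : ℝ) (z : EuclideanSpace ℝ (Fin d)) :
    ∃ T : EuclideanSpace ℝ (Fin d) →L[ℝ] EuclideanSpace ℝ (Fin d),
      HasFDerivAt (posteriorMean Φ a s) ((a / s ^ 2) • T) z ∧
      (∀ u w, ⟪T u, w⟫ = ⟪T w, u⟫) ∧ (∀ u, u ≠ 0 → 0 < ⟪T u, u⟫) ∧
      ∀ u, ⟪T u, u⟫ ≤ ‖u‖ ^ 2 / (γ + a ^ 2 / s ^ 2) := by
  have hq : 0 ≤ a ^ 2 / s ^ 2 := by positivity
  have hk := hΦ.isGaussianWeight hγ hq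
  obtain ⟨T, hT, hcov⟩ := hk.exists_hasFDerivAt_tiltMean ((a / s ^ 2) • z)
  refine ⟨T, ?_, fun u w => ?_, fun u hu => ?_, fun u => ?_⟩
  · have h1 : HasFDerivAt (fun z : EuclideanSpace ℝ (Fin d) => (a / s ^ 2) • z)
        ((a / s ^ 2) • ContinuousLinearMap.id ℝ (EuclideanSpace ℝ (Fin d))) z :=
      (hasFDerivAt_id z).const_smul (a / s ^ 2)
    convert! hT.comp z h1 using 1
    ext1 u
    simp
  · rw [hcov, hcov]
    simp only [mul_comm ⟪_, u⟫]
  · rw [hcov]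
    exact mul_pos (inv_pos.2 (hk.tiltMass_pos _)) (hk.cov_pos _ _ hu)
  · exact hk.fderiv_tiltMean_le (by positivity) (hΦ.posteriorWeight_mul_le _) hT u

/-- The chain-rule factor `α/σ²` of the posterior mean times its coefficient in the velocity is
exactly `covCoeff`. -/
theorem StronglyLogConcavePotential.exists_hasFDerivAt_velocityField {γ : ℝ}
    {Φ : EuclideanSpace ℝ (Fin d) → ℝ} (hΦ : StronglyLogConcavePotential γ Φ) (hγ : 0 < γ)
    (α σ : ℝ → ℝ) (t : ℝ) (z : EuclideanSpace ℝ (Fin d)) :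
    ∃ T : EuclideanSpace ℝ (Fin d) →L[ℝ] EuclideanSpace ℝ (Fin d),
      HasFDerivAt (fun z => (timeDeriv σ t / σ t) • z
        + (timeDeriv α t - timeDeriv σ t * α t / σ t) • posteriorMean Φ (α t) (σ t) z)
        ((timeDeriv σ t / σ t) • ContinuousLinearMap.id ℝ (EuclideanSpace ℝ (Fin d))
          + covCoeff α σ t • T) z ∧
      (∀ u w, ⟪T u, w⟫ = ⟪T w, u⟫) ∧ (∀ u, u ≠ 0 → 0 < ⟪T u, u⟫) ∧
      ∀ u, ⟪T u, u⟫ ≤ ‖u‖ ^ 2 / (γ + α t ^ 2 / σ t ^ 2) := by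
  obtain ⟨T, hT, h⟩ := hΦ.exists_hasFDerivAt_posteriorMean hγ (α t) (σ t) z
  refine ⟨T, ?_, h⟩
  rw [covCoeff, mul_smul]
  exact ((hasFDerivAt_id z).const_smul (timeDeriv σ t / σ t)).add
    (hT.const_smul (timeDeriv α t - timeDeriv σ t * α t / σ t))

theorem velocityField_bounds {γ : ℝ} (hγ : 0 < γ) {Φ : EuclideanSpace ℝ (Fin d) → ℝ}
    (hΦ : StronglyLogConcavePotential γ Φ) {α σ : ℝ → ℝ} {t : ℝ} (ht : t ∈ Ioc (0 : ℝ) 1)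
    (hαd : DifferentiableWithinAt ℝ α (Icc 0 1) t)
    (hσd : DifferentiableWithinAt ℝ σ (Icc 0 1) t) (hσ : 0 < σ t)
    {v : EuclideanSpace ℝ (Fin d) → EuclideanSpace ℝ (Fin d)}
    (hv : v = fun z => (timeDeriv σ t / σ t) • z
        + (timeDeriv α t - timeDeriv σ t * α t / σ t) • posteriorMean Φ (α t) (σ t) z) :
    Differentiable ℝ v ∧
      (covCoeff α σ t ≤ 0 → ∀ z,
        (jacobianMatrix v z
          - lowerRate γ α σ t • (1 : Matrix (Fin d) (Fin d) ℝ)).PosSemidef ∧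
        (upperRate σ t • (1 : Matrix (Fin d) (Fin d) ℝ)
          - jacobianMatrix v z).PosSemidef) ∧
      (covCoeff α σ t < 0 → ∀ z,
        (upperRate σ t • (1 : Matrix (Fin d) (Fin d) ℝ)
          - jacobianMatrix v z).PosDef) := by
  have hd := hΦ.exists_hasFDerivAt_velocityField hγ α σ t
  rw [← hv] at hd
  rw [upperRate_eq ht hσd hσ, lowerRate_eq hγ ht hαd hσd hσ]
  refine ⟨fun z => ?_, fun hc z => ⟨?_, ?_⟩, fun hc z => ?_⟩ <;>
    obtain ⟨T, hT, hsymm, hpos, hle⟩ := hd z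
  · exact hT.differentiableAt
  · rw [jacobianMatrix_sub_smul_one hT]
    refine posSemidef_euclideanMatrix (fun u w => ?_) fun u => ?_
    · simp only [sub_apply, add_apply, smul_apply, ContinuousLinearMap.id_apply, inner_sub_left,
        inner_add_left, real_inner_smul_left, hsymm u w, real_inner_comm u w]
    · simp only [sub_apply, add_apply, smul_apply, ContinuousLinearMap.id_apply, inner_sub_left,
        inner_add_left, real_inner_smul_left, real_inner_self_eq_norm_sq]
      -- The sign of `covCoeff` turns the upper bound on the covariance into the lower bound on the
      -- Jacobian.
      have h1 := mul_le_mul_of_nonpos_left (hle u) hc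
      have h2 : covCoeff α σ t / (γ + α t ^ 2 / σ t ^ 2) * ‖u‖ ^ 2
        = covCoeff α σ t * (‖u‖ ^ 2 / (γ + α t ^ 2 / σ t ^ 2)) := by ring
      linarith
  · rw [smul_one_sub_jacobianMatrix hT]
    refine posSemidef_euclideanMatrix (fun u w => ?_) fun u => ?_
    · simp only [sub_apply, add_apply, smul_apply, ContinuousLinearMap.id_apply, inner_sub_left,
        inner_add_left, real_inner_smul_left, hsymm u w, real_inner_comm u w]
    · simp only [sub_apply, add_apply, smul_apply, ContinuousLinearMap.id_apply, inner_sub_left,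
        inner_add_left, real_inner_smul_left]
      have hnn : 0 ≤ ⟪T u, u⟫ := by
        rcases eq_or_ne u 0 with rfl | hu
        · simp
        · exact (hpos u hu).le
      have := mul_nonpos_of_nonpos_of_nonneg hc hnn
      linarith
  · rw [smul_one_sub_jacobianMatrix hT]
    refine posDef_euclideanMatrix (fun u w => ?_) fun u hu => ?_
    · simp only [sub_apply, add_apply, smul_apply, ContinuousLinearMap.id_apply, inner_sub_left,
        inner_add_left, real_inner_smul_left, hsymm u w, real_inner_comm u w]
    · simp only [sub_apply, add_apply, smul_apply, ContinuousLinearMap.id_apply, inner_sub_left,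
        inner_add_left, real_inner_smul_left]
      have := mul_neg_of_neg_of_pos hc (hpos u hu)
      linarith

/-- The closed form shows the sign on `(0, 1]`, and that strictness is available only for `t < 1`,
since the coefficient vanishes at `t = 1`. -/
theorem covCoeff_linear {t : ℝ} (ht : t ∈ Ioc (0 : ℝ) 1) :
    covCoeff (fun s => 1 - s) (fun s => s) t = -((1 - t) / t ^ 3) := by
  have hu := uniqueDiffWithinAt_Icc_zero_one ht
  have h1 : timeDeriv (fun s => 1 - s) t = -1 :=
    ((hasDerivWithinAt_id t _).const_sub 1).derivWithin hu
  have h2 : timeDeriv (fun s => s) t = 1 := (hasDerivWithinAt_id t _).derivWithin hu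
  have ht0 : t ≠ 0 := ht.1.ne'
  rw [covCoeff, h1, h2]
  field_simp
  ring

end JacobianBounds

theorem proposition2 {d : ℕ} {γ : ℝ} (hγ : 0 < γ) (Φ : EuclideanSpace ℝ (Fin d) → ℝ)
    (hΦ : StronglyLogConcavePotential γ Φ)
    {Ω : Type*} [MeasurableSpace Ω] (μ : Measure Ω) [IsProbabilityMeasure μ]
    (Z₀ Z₁ : Ω → EuclideanSpace ℝ (Fin d)) (hZ₀ : Measurable Z₀) (hZ₁ : Measurable Z₁)
    (hlaw₀ : μ.map Z₀ = densityMeasure Φ)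
    (hlaw₁ : μ.map Z₁ = stdGaussian (EuclideanSpace ℝ (Fin d)))
    (hindep : IndepFun Z₀ Z₁ μ) :
    (∀ (α σ : ℝ → ℝ) (t : ℝ), t ∈ Ioc (0 : ℝ) 1 →
      DifferentiableWithinAt ℝ α (Icc 0 1) t → DifferentiableWithinAt ℝ σ (Icc 0 1) t →
      0 < σ t →
      (∃! v, IsVelocityFieldAt μ α σ Z₀ Z₁ t v) ∧
      ∀ v, IsVelocityFieldAt μ α σ Z₀ Z₁ t v →
        Differentiable ℝ v ∧
        (covCoeff α σ t ≤ 0 → ∀ z,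
          (jacobianMatrix v z
            - lowerRate γ α σ t • (1 : Matrix (Fin d) (Fin d) ℝ)).PosSemidef ∧
          (upperRate σ t • (1 : Matrix (Fin d) (Fin d) ℝ)
            - jacobianMatrix v z).PosSemidef) ∧
        (covCoeff α σ t < 0 → ∀ z,
          (upperRate σ t • (1 : Matrix (Fin d) (Fin d) ℝ)
            - jacobianMatrix v z).PosDef)) ∧
    (∀ t ∈ Ioc (0 : ℝ) 1,
      ∀ v, IsVelocityFieldAt μ (fun s => 1 - s) (fun s => s) Z₀ Z₁ t v → ∀ z,
        (jacobianMatrix v z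
          - lowerRate γ (fun s => 1 - s) (fun s => s) t •
            (1 : Matrix (Fin d) (Fin d) ℝ)).PosSemidef ∧
        (upperRate (fun s => s) t • (1 : Matrix (Fin d) (Fin d) ℝ)
          - jacobianMatrix v z).PosSemidef ∧
        (t < 1 → covCoeff (fun s => 1 - s) (fun s => s) t < 0 ∧
          (upperRate (fun s => s) t • (1 : Matrix (Fin d) (Fin d) ℝ)
            - jacobianMatrix v z).PosDef)) := by

  have hexists := fun (α σ : ℝ → ℝ) (t : ℝ) (hσ : 0 < σ t) =>
    hΦ.isVelocityFieldAt hγ hZ₀ hZ₁ hlaw₀ hlaw₁ hindep α σ hσ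
  have hunique := fun (α σ : ℝ → ℝ) (t : ℝ) (hσ : 0 < σ t) v
      (hv : IsVelocityFieldAt μ α σ Z₀ Z₁ t v) =>
    hΦ.isVelocityFieldAt_unique hZ₀ hZ₁ hlaw₀ hlaw₁ hindep hσ hv (hexists α σ t hσ)
  refine ⟨fun α σ t ht hα hσ hσ0 => ⟨⟨_, hexists α σ t hσ0, hunique α σ t hσ0⟩, fun v hv =>
    velocityField_bounds hγ hΦ ht hα hσ hσ0 (hunique α σ t hσ0 v hv)⟩, fun t ht v hv z => ?_⟩
  obtain ⟨-, hle, hlt⟩ := velocityField_bounds hγ hΦ ht (by fun_prop) (by fun_prop) ht.1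
    (hunique (fun s => 1 - s) (fun s => s) t ht.1 v hv)
  have hc := covCoeff_linear ht
  have hc0 : covCoeff (fun s => 1 - s) (fun s => s) t ≤ 0 := by
    rw [hc, neg_nonpos]
    exact div_nonneg (by linarith [ht.2]) (pow_nonneg ht.1.le 3)
  refine ⟨(hle hc0 z).1, (hle hc0 z).2, fun ht1 => ?_⟩
  have hc1 : covCoeff (fun s => 1 - s) (fun s => s) t < 0 := by
    rw [hc, neg_lt_zero]
    exact div_pos (by linarith) (pow_pos ht.1 3)
  exact ⟨hc1, hlt hc1 z⟩
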